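/- **Theorem 3.7.** A signed graph $\Gamma=(G,\sigma)$ is a simple graph $G$ with a signing $\sigma:E(G)\to\{-1,1\}$; its adjacency matrix has entry $\sigma(uv)$ at $(u,v)$ if $uv\in E(G)$ and $0$ otherwise, and its eigenvalues $\mu_1,\dots,\mu_n$ are those of this matrix, counted with multiplicity. Its Estrada index is $EE(\Gamma)=\sum_{i=1}^n e^{\mu_i}$. It has the pairing property if, for every real $\mu$, the multiplicities of $\mu$ and $-\mu$ as eigenvalues (zero for a non-eigenvalue) are equal. The sign of a cycle is the product of the signs of its edges; $\Gamma$ is unbalanced if some cycle is negative. It is bicyclic if it is connected and has exactly one more edge than vertices. Two signed graphs are called switching equivalent if, up to isomorphism of signed graphs, one is obtained from the other by reversing the signs of all edges between some vertex set $Z$ and its complement. Let $n\ge 5$ and let $\Gamma_p^-(n,n+1)$ be the set of all unbalanced bicyclic signed graphs on $n$ vertices with the pairing property. Let $\Gamma_1$ be the signed graph on $n$ vertices consisting of a positive triangle and a negative triangle which share exactly one vertex $v$, together with $n-5$ pendant vertices attached to $v$. Let $\Gamma_2$ be the signed graph on $n$ vertices consisting of a positive triangle and a negative triangle which share exactly one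 edge $vw$, together with $n-4$ pendant vertices attached to $v$. (Both are determined up to switching equivalence.) Then $\Gamma_1,\Gamma_2\in\Gamma_p^-(n,n+1)$, $$EE(\Gamma_1)>EE(\Gamma_2),$$ and for every $\Gamma\in\Gamma_p^-(n,n+1)$ that is switching equivalent to neither $\Gamma_1$ nor $\Gamma_2$, $$EE(\Gamma_2)>EE(\Gamma).$$ -/

import Mathlib

noncomputable section

/-- A signed graph `(G, σ)` on the vertex set `V`: a simple graph `G` together with a
signing `σ : E(G) → {-1, 1}`. -/
structure SignedGraph (V : Type*) where
  graph : SimpleGraph V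
  sign : graph.edgeSet → ℤˣ

namespace SignedGraph

/-- The sign of an edge given by its two adjacent end vertices. -/
def adjSign {V : Type*} (Γ : SignedGraph V) {u v : V} (h : Γ.graph.Adj u v) : ℤˣ :=
  Γ.sign ⟨s(u, v), h⟩

theorem adjSign_symm {V : Type*} (Γ : SignedGraph V) {u v : V} (h : Γ.graph.Adj u v) :
    Γ.adjSign h.symm = Γ.adjSign h := by
  unfold adjSign
  congr 1
  exact Subtype.ext Sym2.eq_swap

open Classical in
/-- The adjacency matrix: the entry at `(u, v)` is the sign of the edge `uv` if `u` and `v`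
are adjacent, and `0` otherwise. -/
def adjMatrix {V : Type*} (Γ : SignedGraph V) : Matrix V V ℝ :=
  Matrix.of fun u v => if h : Γ.graph.Adj u v then (((Γ.adjSign h : ℤˣ) : ℤ) : ℝ) else 0

theorem isHermitian_adjMatrix {V : Type*} (Γ : SignedGraph V) : Γ.adjMatrix.IsHermitian := by
  ext u v
  simp only [adjMatrix, Matrix.conjTranspose_apply, Matrix.of_apply, star_trivial]
  by_cases h : Γ.graph.Adj u v
  · rw [dif_pos h, dif_pos h.symm, adjSign_symm]
  · rw [dif_neg h, dif_neg fun h' => h h'.symm]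

/-- The eigenvalues of a signed graph (those of its adjacency matrix), listed with
multiplicity. -/
def eigenvalues {V : Type*} [Fintype V] [DecidableEq V] (Γ : SignedGraph V) : V → ℝ :=
  Γ.isHermitian_adjMatrix.eigenvalues

/-- The Estrada index: the sum of `exp μ` over all eigenvalues `μ`, with multiplicity. -/
def estradaIndex {V : Type*} [Fintype V] [DecidableEq V] (Γ : SignedGraph V) : ℝ :=
  ∑ i, Real.exp (Γ.eigenvalues i)

/-- The multiplicity of the real number `μ` as an eigenvalue (`0` if it is not one). -/
def multiplicity {V : Type*} [Fintype V] [DecidableEq V] (Γ : SignedGraph V) (μ : ℝ) : ℕ :=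
  Γ.adjMatrix.charpoly.rootMultiplicity μ

/-- The pairing property: `μ` is an eigenvalue whenever `-μ` is, and the two have the same
multiplicity. -/
def HasPairing {V : Type*} [Fintype V] [DecidableEq V] (Γ : SignedGraph V) : Prop :=
  ∀ μ : ℝ, Γ.multiplicity μ = Γ.multiplicity (-μ)

/-- The sign of a walk: the product of the signs of its edges. -/
def walkSign {V : Type*} (Γ : SignedGraph V) : {u v : V} → Γ.graph.Walk u v → ℤˣ
  | _, _, .nil => 1
  | _, _, .cons h p => Γ.adjSign h * walkSign Γ p

/-- A signed graph is balanced if all of its cycles are positive. -/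
def Balanced {V : Type*} (Γ : SignedGraph V) : Prop :=
  ∀ (v : V) (p : Γ.graph.Walk v v), p.IsCycle → Γ.walkSign p = 1

/-- A signed graph is bicyclic if it is connected and has one more edge than vertices. -/
def Bicyclic {V : Type*} [Fintype V] (Γ : SignedGraph V) : Prop :=
  Γ.graph.Connected ∧ Γ.graph.edgeSet.ncard = Fintype.card V + 1

/-- The cut `[Z, V \ Z]`: the pairs with one end in `Z` and the other outside `Z`. -/
def cut {V : Type*} (Z : Set V) : Set (Sym2 V) :=
  {e | ∃ u ∈ Z, ∃ v ∉ Z, e = s(u, v)}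

open Classical in
/-- The switched signed graph `Γ^Z`: the signs of the edges in the cut `[Z, V \ Z]` are
reversed. -/
def switch {V : Type*} (Γ : SignedGraph V) (Z : Set V) : SignedGraph V where
  graph := Γ.graph
  sign e := if (e : Sym2 V) ∈ cut Z then -Γ.sign e else Γ.sign e

/-- Two signed graphs are isomorphic if a graph isomorphism between the underlying graphs
preserves the signs of all edges. -/
def Isomorphic {V W : Type*} (Γ : SignedGraph V) (Δ : SignedGraph W) : Prop :=
  ∃ f : Γ.graph ≃g Δ.graph,
    ∀ (u v : V) (h : Γ.graph.Adj u v), Δ.adjSign (f.map_adj_iff.2 h) = Γ.adjSign h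

/-- Switching equivalence of signed graphs, where isomorphic signed graphs are identified:
some switching of the first is isomorphic to the second. -/
def SwitchingEquivalent {V W : Type*} (Γ : SignedGraph V) (Δ : SignedGraph W) : Prop :=
  ∃ Z : Set V, (Γ.switch Z).Isomorphic Δ

/-- The set of all unbalanced bicyclic signed graphs on `n` (labelled) vertices that have the
pairing property. -/
def unbalancedBicyclicPairing (n : ℕ) : Set (SignedGraph (Fin n)) :=
  {Γ | Γ.Bicyclic ∧ ¬ Γ.Balanced ∧ Γ.HasPairing}

/-- The signed graph `Γ₁` on the vertices `0, …, n - 1` (meant for `5 ≤ n`): a positive triangle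
`0 3 4` and a negative triangle `0 1 2` (with negative edge `1 2`) share exactly the vertex `0`,
and the other `n - 5` vertices are pendant vertices at `0`. -/
def gamma₁ (n : ℕ) : SignedGraph (Fin n) where
  graph := SimpleGraph.fromRel fun i j =>
    i.val = 0 ∨ (i.val = 1 ∧ j.val = 2) ∨ (i.val = 3 ∧ j.val = 4)
  sign e := if (e : Sym2 (Fin n)).map Fin.val = s(1, 2) then -1 else 1

/-- The signed graph `Γ₂` on the vertices `0, …, n - 1` (meant for `4 ≤ n`): a positive triangle
`0 1 2` and a negative triangle `0 1 3` (with negative edge `1 3`) share exactly the edge `0 1`,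
and the other `n - 4` vertices are pendant vertices at `0`. -/
def gamma₂ (n : ℕ) : SignedGraph (Fin n) where
  graph := SimpleGraph.fromRel fun i j =>
    i.val = 0 ∨ (i.val = 1 ∧ j.val = 2) ∨ (i.val = 1 ∧ j.val = 3)
  sign e := if (e : Sym2 (Fin n)).map Fin.val = s(1, 3) then -1 else 1

end SignedGraph

end

open Finset

/-! The pairing property makes the Estrada index a sum of `cosh` over the eigenvalues. The terms `1`
and `x² / 2` contribute the same amount for every bicyclic graph on `n` vertices, because `∑ μ² =
2(n + 1)`. Only `∑ coshTail (μ²)` varies, and it increases with the even moments from the fourth on.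

The spectrum of `Γ₂` is `±√t, ±√s, 0, …, 0` with `t + s = n + 1` and `ts = 2n - 4`. For a
competitor, `∑ μ⁴ ≤ 2C` and `μ² ≤ B` bound every higher moment by `2C·Bᵏ`, to be compared with
`2(tᵏ⁺² + sᵏ⁺²)`. Since `±μ` both occur, `2μ⁴ ≤ ∑ μ⁴`, so `C = t²` forces `B = t` and settles the
comparison. This reduces the last claim to a bound on the fourth moment (`quartic`) and a
classification.

A vertex adjacent to all others leaves only two further edges. After switching its row to `+1`,
unbalancedness makes one of the two negative, and `tr A³ = 0` (from pairing) makes the other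
positive. They share an end or not, which gives `Γ₂` or `Γ₁` (`switchingEquivalent_of_center`).

If every degree is at most `n - 2`, then `quartic ≤ 2n² - 8n + 38` (`quartic_bounds`). The induction
deletes a pendant vertex at `p`, which lowers the fourth moment by exactly `4d(p) - 2`. Without
pendant vertices, `quartic_eq` expresses the moment through the degrees and the signed number of
4-cycles. Over the field with two elements the cycle space has dimension two and its positive part
dimension at most one. So there is at most one positive 4-cycle, and none in the presence of a
triangle, because `tr A³ = 0` then supplies a positive triangle. Orders four and five rest on a
finite check.

The fourth-moment bound falls below `2t²` for `n ≥ 7`. Order five uses the sharper bound `44`, and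
order six a Cauchy–Schwarz estimate of the largest eigenvalue. Finally `EE(Γ₁) > EE(Γ₂)` because the
largest squared eigenvalue `T` of `Γ₁` alone satisfies `T² > t² + s²`. -/

/-- `A` is the adjacency matrix of a signed graph. -/
structure IsSignedAdj {V : Type*} (A : Matrix V V ℤ) : Prop where
  symm : ∀ u v, A u v = A v u
  diag : ∀ u, A u u = 0
  entry : ∀ u v, A u v = 0 ∨ A u v = 1 ∨ A u v = -1

/-- The graph whose edges are the positions of the nonzero entries of `A`. -/
def supportGraph {V : Type*} (A : Matrix V V ℤ) : SimpleGraph V :=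
  SimpleGraph.fromRel fun u v => A u v ≠ 0

/-- A `±1`-valued vertex function whose coboundary is the signing `A`. -/
def IsPotential {V : Type*} (A : Matrix V V ℤ) (θ : V → ℤ) : Prop :=
  (∀ u, θ u = 1 ∨ θ u = -1) ∧ ∀ u v, A u v ≠ 0 → A u v = θ u * θ v

theorem IsSignedAdj.adj_iff {V : Type*} {A : Matrix V V ℤ} (hA : IsSignedAdj A) (u v : V) :
    (supportGraph A).Adj u v ↔ A u v ≠ 0 := by
  simp only [supportGraph, SimpleGraph.fromRel_adj, hA.symm v u, or_self, and_iff_right_iff_imp]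
  rintro h rfl
  exact h (hA.diag u)

/-- The adjacency matrix of an unbalanced bicyclic signed graph with as many positive as
negative triangles. -/
structure IsUnbalancedBicyclic {V : Type*} [Fintype V] (A : Matrix V V ℤ) : Prop
    extends IsSignedAdj A where
  conn : (supportGraph A).Connected
  size : ∑ u, ∑ v, A u v ^ 2 = 2 * (Fintype.card V : ℤ) + 2
  unbalanced : ∀ θ, ¬ IsPotential A θ
  cubic : ∑ u, ∑ v, ∑ w, A u v * A v w * A w u = 0

theorem IsSignedAdj.sq_eq {V : Type*} {A : Matrix V V ℤ} (hA : IsSignedAdj A) (u v : V) :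
    A u v ^ 2 = if A u v ≠ 0 then 1 else 0 := by
  rcases hA.entry u v with h | h | h <;> simp [h]

theorem IsSignedAdj.sum_sq_eq_degree {V : Type*} [Fintype V] {A : Matrix V V ℤ}
    (hA : IsSignedAdj A) (u : V) [Fintype ((supportGraph A).neighborSet u)] :
    ∑ v, A u v ^ 2 = (supportGraph A).degree u := by
  classical
  simp only [hA.sq_eq]
  rw [Finset.sum_boole, ← SimpleGraph.card_neighborFinset_eq_degree]
  congr 2
  ext v
  simp [hA.adj_iff]

theorem IsUnbalancedBicyclic.card_edgeSet {V : Type*} [Fintype V] {A : Matrix V V ℤ}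
    (hA : IsUnbalancedBicyclic A) :
    Nat.card (supportGraph A).edgeSet = Fintype.card V + 1 := by
  classical
  have h := hA.size
  simp only [hA.toIsSignedAdj.sum_sq_eq_degree] at h
  have h2 := (supportGraph A).sum_degrees_eq_twice_card_edges
  rw [← Nat.cast_sum, h2] at h
  rw [SimpleGraph.edgeFinset, Set.toFinset_card, ← Nat.card_eq_fintype_card] at h
  push_cast at h
  omega

/-! ### The cycle space -/

section CycleSpace

variable {V : Type*} (A : Matrix V V ℤ)

/-- Functions on the edges with values in the field with two elements. -/
abbrev EdgeSpace := (supportGraph A).edgeSet → ZMod 2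

open Classical in
/-- Evaluation of an edge function at the unordered pair `e`, zero if `e` is not an edge. -/
noncomputable def edgeEval (e : Sym2 V) : Module.Dual (ZMod 2) (EdgeSpace A) :=
  if h : e ∈ (supportGraph A).edgeSet then LinearMap.proj ⟨e, h⟩ else 0

/-- The coboundary map from vertex functions to edge functions. -/
def coboundary : (V → ZMod 2) →ₗ[ZMod 2] EdgeSpace A where
  toFun θ e := Sym2.lift ⟨fun u v => θ u + θ v, fun _ _ => add_comm _ _⟩ e.1
  map_add' θ η := by
    funext ⟨e, he⟩
    induction e with
    | _ u v => simp only [Pi.add_apply, Sym2.lift_mk]; ring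
  map_smul' c θ := by
    funext ⟨e, he⟩
    induction e with
    | _ u v => simp only [Pi.smul_apply, Sym2.lift_mk, smul_eq_mul, RingHom.id_apply]; ring

/-- The signing as an edge function: `1` on negative edges and `0` on positive ones. -/
def signVector : EdgeSpace A := fun e =>
  Sym2.lift ⟨fun u v => if A u v = -1 ∨ A v u = -1 then 1 else 0, fun u v => by
    simp only [or_comm]⟩ e.1

variable {A}

theorem edgeEval_coboundary (hA : IsSignedAdj A) {u v : V} (h : A u v ≠ 0) (θ : V → ZMod 2) :
    edgeEval A s(u, v) (coboundary A θ) = θ u + θ v := by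
  have h' : s(u, v) ∈ (supportGraph A).edgeSet := (hA.adj_iff u v).2 h
  rw [edgeEval, dif_pos h']
  rfl

theorem edgeEval_signVector (hA : IsSignedAdj A) {u v : V} (h : A u v ≠ 0) :
    edgeEval A s(u, v) (signVector A) = if A u v = -1 then 1 else 0 := by
  have h' : s(u, v) ∈ (supportGraph A).edgeSet := (hA.adj_iff u v).2 h
  rw [edgeEval, dif_pos h']
  simp [signVector, hA.symm v u]

open Classical in
theorem edgeEval_single (hA : IsSignedAdj A) {u v : V} (h : A u v ≠ 0)
    (e : (supportGraph A).edgeSet) :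
    edgeEval A s(u, v) (Pi.single e 1) = if s(u, v) = e.1 then 1 else 0 := by
  have h' : s(u, v) ∈ (supportGraph A).edgeSet := (hA.adj_iff u v).2 h
  rw [edgeEval, dif_pos h', LinearMap.proj_apply, Pi.single_apply]
  simp only [Subtype.ext_iff]

theorem zmod_two_eq (x : ZMod 2) : x = 0 ∨ x = 1 := by
  revert x; decide

/-- A preimage of the sign vector, read multiplicatively as `±1`, would be a potential. -/
theorem IsUnbalancedBicyclic.signVector_notMem [Fintype V] (hA : IsUnbalancedBicyclic A) :
    signVector A ∉ LinearMap.range (coboundary A) := by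
  rintro ⟨θ, hθ⟩
  apply hA.unbalanced fun u => if θ u = 0 then 1 else -1
  refine ⟨fun u => by by_cases hu : θ u = 0 <;> simp [hu], fun u v h => ?_⟩
  have h1 := edgeEval_coboundary hA.toIsSignedAdj h θ
  rw [hθ, edgeEval_signVector hA.toIsSignedAdj h] at h1
  rcases hA.entry u v with h2 | h2 | h2
  · exact absurd h2 h
  all_goals
    rcases zmod_two_eq (θ u) with hu | hu <;> rcases zmod_two_eq (θ v) with hv | hv <;>
      simp [h2, hu, hv] at h1 ⊢

/-- By connectedness the kernel consists of the constants only; the rest is rank–nullity. -/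
theorem IsUnbalancedBicyclic.finrank_range_coboundary [Fintype V]
    (hA : IsUnbalancedBicyclic A) :
    Fintype.card V ≤ Module.finrank (ZMod 2) (LinearMap.range (coboundary A)) + 1 := by
  have h1 := LinearMap.finrank_range_add_finrank_ker (coboundary A)
  rw [Module.finrank_fintype_fun_eq_card] at h1
  have h2 : Module.finrank (ZMod 2) (LinearMap.ker (coboundary A)) ≤ 1 := by
    rw [finrank_le_one_iff]
    obtain ⟨r⟩ := hA.conn.nonempty
    have hone : (fun _ => 1 : V → ZMod 2) ∈ LinearMap.ker (coboundary A) := by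
      rw [LinearMap.mem_ker]
      funext ⟨e, he⟩
      induction e with
      | _ u v => exact (by decide : (1 : ZMod 2) + 1 = 0)
    refine ⟨⟨_, hone⟩, fun θ => ⟨θ.1 r, ?_⟩⟩
    ext v
    have hconst : ∀ u w, (supportGraph A).Adj u w → θ.1 u = θ.1 w := by
      intro u w h
      have h3 := edgeEval_coboundary hA.toIsSignedAdj ((hA.adj_iff u w).1 h) θ.1
      rw [LinearMap.mem_ker.1 θ.2, map_zero] at h3
      exact (CharTwo.add_eq_zero.1 h3.symm)
    have hreach : ∀ w, (supportGraph A).Reachable r w → θ.1 r = θ.1 w := by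
      rintro w ⟨p⟩
      induction p with
      | nil => rfl
      | cons h p ih => exact (hconst _ _ h).trans ih
    simpa using hreach v (hA.conn.preconnected r v)
  omega

/-- The cycle space has dimension two, so its positive part has exactly one nonzero element. -/
theorem IsUnbalancedBicyclic.dual_unique [Fintype V] (hA : IsUnbalancedBicyclic A)
    {φ ψ : Module.Dual (ZMod 2) (EdgeSpace A)} (hφ : φ ≠ 0) (hψ : ψ ≠ 0)
    (hφc : ∀ θ, φ (coboundary A θ) = 0) (hψc : ∀ θ, ψ (coboundary A θ) = 0)
    (hφs : φ (signVector A) = 0) (hψs : ψ (signVector A) = 0) : φ = ψ := by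
  classical
  set W : Submodule (ZMod 2) (EdgeSpace A) :=
    LinearMap.range (coboundary A) ⊔ Submodule.span (ZMod 2) {signVector A} with hW
  have hlt : LinearMap.range (coboundary A) < W := by
    refine lt_of_le_of_ne le_sup_left fun h => hA.signVector_notMem ?_
    rw [h]
    exact Submodule.mem_sup_right (Submodule.mem_span_singleton_self _)
  have h1 := Submodule.finrank_lt_finrank_of_lt hlt
  have h2 := Subspace.finrank_add_finrank_dualAnnihilator_eq W
  rw [Module.finrank_fintype_fun_eq_card, ← Nat.card_eq_fintype_card, hA.card_edgeSet] at h2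
  have h3 := hA.finrank_range_coboundary
  -- The cut space has dimension at least `n - 1` and the sign vector adds one, inside a space of
  -- dimension `n + 1`.
  have h4 : Module.finrank (ZMod 2) W.dualAnnihilator ≤ 1 := by omega
  have hmem : ∀ χ : Module.Dual (ZMod 2) (EdgeSpace A), (∀ θ, χ (coboundary A θ) = 0) →
      χ (signVector A) = 0 → χ ∈ W.dualAnnihilator := by
    intro χ hc hs
    rw [Submodule.mem_dualAnnihilator]
    intro w hw
    obtain ⟨_, ⟨θ, rfl⟩, y, hy, rfl⟩ := Submodule.mem_sup.1 hw
    obtain ⟨c, rfl⟩ := Submodule.mem_span_singleton.1 hy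
    simp [hc, hs]
  obtain ⟨χ, hχ⟩ := finrank_le_one_iff.1 h4
  have key : ∀ ξ : Module.Dual (ZMod 2) (EdgeSpace A), ξ ∈ W.dualAnnihilator → ξ ≠ 0 →
      ξ = χ.1 := by
    intro ξ hξ h0
    obtain ⟨c, hc⟩ := hχ ⟨ξ, hξ⟩
    rcases zmod_two_eq c with rfl | rfl
    · simp only [zero_smul] at hc
      exact absurd (congrArg Subtype.val hc).symm h0
    · simpa using (congrArg Subtype.val hc).symm
  rw [key φ (hmem φ hφc hφs) hφ, key ψ (hmem ψ hψc hψs) hψ]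

end CycleSpace

/-! ### Positive cycles of length three and four -/

section Cycles

variable {V : Type*} {A : Matrix V V ℤ}

theorem IsSignedAdj.ne_of_ne_zero (hA : IsSignedAdj A) {u v : V} (h : A u v ≠ 0) : u ≠ v := by
  rintro rfl
  exact h (hA.diag u)

/-- The four edges of the closed walk `a b c d a` as a functional on edge functions. -/
noncomputable def fourCycle (A : Matrix V V ℤ) (a b c d : V) : Module.Dual (ZMod 2) (EdgeSpace A) :=
  edgeEval A s(a, b) + edgeEval A s(b, c) + edgeEval A s(c, d) + edgeEval A s(d, a)

/-- The three edges of the closed walk `a b c a` as a functional on edge functions. -/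
noncomputable def threeCycle (A : Matrix V V ℤ) (a b c : V) : Module.Dual (ZMod 2) (EdgeSpace A) :=
  edgeEval A s(a, b) + edgeEval A s(b, c) + edgeEval A s(c, a)

/-- `a b c d` is a positive cycle of length four. -/
structure IsPositiveFourCycle (A : Matrix V V ℤ) (a b c d : V) : Prop where
  ne₁ : a ≠ c
  ne₂ : b ≠ d
  sign : A a b * A b c * A c d * A d a = 1

theorem IsPositiveFourCycle.ne_zero {a b c d : V} (h : IsPositiveFourCycle A a b c d) :
    A a b ≠ 0 ∧ A b c ≠ 0 ∧ A c d ≠ 0 ∧ A d a ≠ 0 := by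
  have h1 := h.sign
  refine ⟨?_, ?_, ?_, ?_⟩ <;> intro h0 <;> simp [h0] at h1

theorem fourCycle_coboundary (hA : IsSignedAdj A) {a b c d : V}
    (h : IsPositiveFourCycle A a b c d) (θ : V → ZMod 2) :
    fourCycle A a b c d (coboundary A θ) = 0 := by
  obtain ⟨h1, h2, h3, h4⟩ := h.ne_zero
  simp only [fourCycle, LinearMap.add_apply, edgeEval_coboundary hA, ne_eq, h1, h2, h3, h4,
    not_false_eq_true]
  generalize θ a = x, θ b = y, θ c = z, θ d = w
  revert x y z w
  decide

theorem threeCycle_coboundary (hA : IsSignedAdj A) {a b c : V}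
    (h : A a b * A b c * A c a = 1) (θ : V → ZMod 2) :
    threeCycle A a b c (coboundary A θ) = 0 := by
  have h1 : A a b ≠ 0 := by intro h0; simp [h0] at h
  have h2 : A b c ≠ 0 := by intro h0; simp [h0] at h
  have h3 : A c a ≠ 0 := by intro h0; simp [h0] at h
  simp only [threeCycle, LinearMap.add_apply, edgeEval_coboundary hA, ne_eq, h1, h2, h3,
    not_false_eq_true]
  generalize θ a = x, θ b = y, θ c = z
  revert x y z
  decide

theorem fourCycle_signVector (hA : IsSignedAdj A) {a b c d : V}
    (h : IsPositiveFourCycle A a b c d) : fourCycle A a b c d (signVector A) = 0 := by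
  obtain ⟨h1, h2, h3, h4⟩ := h.ne_zero
  have hs := h.sign
  simp only [fourCycle, LinearMap.add_apply, edgeEval_signVector hA, ne_eq, h1, h2, h3, h4,
    not_false_eq_true]
  have e1 := (hA.entry a b).resolve_left h1
  have e2 := (hA.entry b c).resolve_left h2
  have e3 := (hA.entry c d).resolve_left h3
  have e4 := (hA.entry d a).resolve_left h4
  rcases e1 with e1 | e1 <;> rcases e2 with e2 | e2 <;> rcases e3 with e3 | e3 <;>
    rcases e4 with e4 | e4 <;> rw [e1, e2, e3, e4] at hs ⊢ <;> first | decide | (exfalso; omega)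

theorem threeCycle_signVector (hA : IsSignedAdj A) {a b c : V}
    (h : A a b * A b c * A c a = 1) : threeCycle A a b c (signVector A) = 0 := by
  have h1 : A a b ≠ 0 := by intro h0; simp [h0] at h
  have h2 : A b c ≠ 0 := by intro h0; simp [h0] at h
  have h3 : A c a ≠ 0 := by intro h0; simp [h0] at h
  simp only [threeCycle, LinearMap.add_apply, edgeEval_signVector hA, ne_eq, h1, h2, h3,
    not_false_eq_true]
  have e1 := (hA.entry a b).resolve_left h1
  have e2 := (hA.entry b c).resolve_left h2
  have e3 := (hA.entry c a).resolve_left h3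
  rcases e1 with e1 | e1 <;> rcases e2 with e2 | e2 <;> rcases e3 with e3 | e3 <;>
    rw [e1, e2, e3] at h ⊢ <;> first | decide | (exfalso; omega)

/-- The edge set of the closed walk `a b c d a`. -/
def fourEdges (a b c d : V) (e : Sym2 V) : Prop :=
  e = s(a, b) ∨ e = s(b, c) ∨ e = s(c, d) ∨ e = s(d, a)

open Classical in
theorem fourCycle_single_eq (hA : IsSignedAdj A) {a b c d : V}
    (h : IsPositiveFourCycle A a b c d) (e : (supportGraph A).edgeSet) :
    fourCycle A a b c d (Pi.single e 1) = (if s(a, b) = e.1 then 1 else 0) +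
      (if s(b, c) = e.1 then 1 else 0) + (if s(c, d) = e.1 then 1 else 0) +
      (if s(d, a) = e.1 then 1 else 0) := by
  obtain ⟨h1, h2, h3, h4⟩ := h.ne_zero
  rw [← edgeEval_single hA h1, ← edgeEval_single hA h2, ← edgeEval_single hA h3,
    ← edgeEval_single hA h4]
  rfl

open Classical in
theorem fourEdges_of_fourCycle_ne_zero (hA : IsSignedAdj A) {a b c d : V}
    (h : IsPositiveFourCycle A a b c d) (e : (supportGraph A).edgeSet)
    (he : fourCycle A a b c d (Pi.single e 1) ≠ 0) : fourEdges a b c d e.1 := by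
  contrapose! he
  simp only [fourEdges, not_or] at he
  rw [fourCycle_single_eq hA h, if_neg (Ne.symm he.1), if_neg (Ne.symm he.2.1),
    if_neg (Ne.symm he.2.2.1), if_neg (Ne.symm he.2.2.2)]
  simp

open Classical in
-- The conditions `a ≠ c` and `b ≠ d` make the four edges distinct, so nothing cancels modulo two.
theorem fourCycle_single (hA : IsSignedAdj A) {a b c d : V}
    (h : IsPositiveFourCycle A a b c d) (e : (supportGraph A).edgeSet)
    (he : fourEdges a b c d e.1) : fourCycle A a b c d (Pi.single e 1) = 1 := by
  obtain ⟨h1, h2, h3, h4⟩ := h.ne_zero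
  have n1 := hA.ne_of_ne_zero h1
  have n2 := hA.ne_of_ne_zero h2
  have n3 := hA.ne_of_ne_zero h3
  have n4 := hA.ne_of_ne_zero h4
  have n5 := h.ne₁
  have n6 := h.ne₂
  rw [fourCycle_single_eq hA h]
  rcases he with he | he | he | he <;> rw [he] <;>
    simp [n1, n2, n3, n4, n5, n6, n1.symm, n2.symm, n3.symm, n4.symm, n5.symm, n6.symm]

theorem fourCycle_eq_of_positive [Fintype V] (hA : IsUnbalancedBicyclic A) {a b c d : V}
    (h : IsPositiveFourCycle A a b c d) {φ : Module.Dual (ZMod 2) (EdgeSpace A)} (h0 : φ ≠ 0)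
    (hc : ∀ θ, φ (coboundary A θ) = 0) (hs : φ (signVector A) = 0) : φ = fourCycle A a b c d := by
  classical
  refine hA.dual_unique h0 ?_ hc (fourCycle_coboundary hA.toIsSignedAdj h) hs
    (fourCycle_signVector hA.toIsSignedAdj h)
  intro h1
  have := fourCycle_single hA.toIsSignedAdj h
    ⟨s(a, b), (hA.adj_iff a b).2 h.ne_zero.1⟩ (Or.inl rfl)
  rw [h1] at this
  exact absurd this (by simp)

theorem fourCycle_ne_zero (hA : IsSignedAdj A) {a b c d : V}
    (h : IsPositiveFourCycle A a b c d) : fourCycle A a b c d ≠ 0 := by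
  classical
  intro h1
  have := fourCycle_single hA h ⟨s(a, b), (hA.adj_iff a b).2 h.ne_zero.1⟩ (Or.inl rfl)
  rw [h1] at this
  exact absurd this (by simp)

/-- Both cycles define the unique nonzero functional of `dual_unique`, and evaluating it on single
edges recovers the edge set. -/
theorem fourEdges_of_positive [Fintype V] (hA : IsUnbalancedBicyclic A) {a b c d x y z w : V}
    (h : IsPositiveFourCycle A a b c d) (h' : IsPositiveFourCycle A x y z w)
    {u v : V} (he : fourEdges x y z w s(u, v)) (huv : A u v ≠ 0) :
    fourEdges a b c d s(u, v) := by
  classical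
  have heq := fourCycle_eq_of_positive hA h (fourCycle_ne_zero hA.toIsSignedAdj h')
    (fourCycle_coboundary hA.toIsSignedAdj h') (fourCycle_signVector hA.toIsSignedAdj h')
  apply fourEdges_of_fourCycle_ne_zero hA.toIsSignedAdj h ⟨s(u, v), (hA.adj_iff u v).2 huv⟩
  rw [← heq, fourCycle_single hA.toIsSignedAdj h' _ he]
  exact one_ne_zero

/-- Equal edge sets leave only the eight dihedral parametrizations of one cycle. -/
theorem positiveFourCycle_cases [Fintype V] (hA : IsUnbalancedBicyclic A) {a b c d x y z w : V}
    (h : IsPositiveFourCycle A a b c d) (h' : IsPositiveFourCycle A x y z w) :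
    (x = a ∧ y = b ∧ z = c ∧ w = d) ∨ (x = b ∧ y = c ∧ z = d ∧ w = a) ∨
    (x = c ∧ y = d ∧ z = a ∧ w = b) ∨ (x = d ∧ y = a ∧ z = b ∧ w = c) ∨
    (x = b ∧ y = a ∧ z = d ∧ w = c) ∨ (x = a ∧ y = d ∧ z = c ∧ w = b) ∨
    (x = d ∧ y = c ∧ z = b ∧ w = a) ∨ (x = c ∧ y = b ∧ z = a ∧ w = d) := by
  obtain ⟨h1, h2, h3, h4⟩ := h'.ne_zero
  have e1 := fourEdges_of_positive hA h h' (Or.inl rfl) h1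
  have e2 := fourEdges_of_positive hA h h' (Or.inr (Or.inl rfl)) h2
  have e3 := fourEdges_of_positive hA h h' (Or.inr (Or.inr (Or.inl rfl))) h3
  have e4 := fourEdges_of_positive hA h h' (Or.inr (Or.inr (Or.inr rfl))) h4
  obtain ⟨k1, k2, k3, k4⟩ := h.ne_zero
  have n1 := hA.ne_of_ne_zero k1
  have n2 := hA.ne_of_ne_zero k2
  have n3 := hA.ne_of_ne_zero k3
  have n4 := hA.ne_of_ne_zero k4
  have n5 := h.ne₁
  have n6 := h.ne₂
  have n7 := h'.ne₁
  have n8 := h'.ne₂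
  simp only [fourEdges, Sym2.eq_iff] at e1 e2 e3 e4
  clear h h' hA h1 h2 h3 h4 k1 k2 k3 k4
  rcases e1 with (⟨rfl, rfl⟩ | ⟨rfl, rfl⟩) | (⟨rfl, rfl⟩ | ⟨rfl, rfl⟩) | (⟨rfl, rfl⟩ | ⟨rfl, rfl⟩) |
    (⟨rfl, rfl⟩ | ⟨rfl, rfl⟩) <;> grind

/-- A positive triangle would give the same functional as the 4-cycle, so the four distinct vertices
of the latter would lie among three. -/
theorem threeCycle_ne_positive [Fintype V] (hA : IsUnbalancedBicyclic A) {a b c d x y z : V}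
    (h : IsPositiveFourCycle A a b c d) (h' : A x y * A y z * A z x = 1) : False := by
  classical
  have h1 : A x y ≠ 0 := by intro h0; simp [h0] at h'
  have h2 : A y z ≠ 0 := by intro h0; simp [h0] at h'
  have h3 : A z x ≠ 0 := by intro h0; simp [h0] at h'
  have n1 := hA.ne_of_ne_zero h1
  have n2 := hA.ne_of_ne_zero h2
  have n3 := hA.ne_of_ne_zero h3
  have val : ∀ e : (supportGraph A).edgeSet, threeCycle A x y z (Pi.single e 1) =
      (if s(x, y) = e.1 then 1 else 0) + (if s(y, z) = e.1 then 1 else 0) +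
      (if s(z, x) = e.1 then 1 else 0) := by
    intro e
    rw [← edgeEval_single hA.toIsSignedAdj h1, ← edgeEval_single hA.toIsSignedAdj h2,
      ← edgeEval_single hA.toIsSignedAdj h3]
    rfl
  have h0 : threeCycle A x y z ≠ 0 := by
    intro h0
    have := val ⟨s(x, y), (hA.adj_iff x y).2 h1⟩
    rw [h0] at this
    simp [n1, n3, n1.symm, n2.symm] at this
  have heq := fourCycle_eq_of_positive hA h h0 (threeCycle_coboundary hA.toIsSignedAdj h')
    (threeCycle_signVector hA.toIsSignedAdj h')
  have mem : ∀ u v, A u v ≠ 0 → fourEdges a b c d s(u, v) → u ∈ ({x, y, z} : Finset V) := by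
    intro u v huv he
    have h4 := fourCycle_single hA.toIsSignedAdj h ⟨s(u, v), (hA.adj_iff u v).2 huv⟩ he
    rw [← heq, val] at h4
    by_contra hu
    simp only [Finset.mem_insert, Finset.mem_singleton, not_or] at hu
    obtain ⟨u1, u2, u3⟩ := hu
    simp [Ne.symm u1, Ne.symm u2, Ne.symm u3] at h4
  obtain ⟨k1, k2, k3, k4⟩ := h.ne_zero
  have hsub : ({a, b, c, d} : Finset V) ⊆ {x, y, z} := by
    intro u hu
    simp only [Finset.mem_insert, Finset.mem_singleton] at hu
    rcases hu with rfl | rfl | rfl | rfl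
    · exact mem _ _ k1 (Or.inl rfl)
    · exact mem _ _ k2 (Or.inr (Or.inl rfl))
    · exact mem _ _ k3 (Or.inr (Or.inr (Or.inl rfl)))
    · exact mem _ _ k4 (Or.inr (Or.inr (Or.inr rfl)))
  have hcard := Finset.card_le_card hsub
  have m1 := hA.ne_of_ne_zero k1
  have m2 := hA.ne_of_ne_zero k2
  have m3 := hA.ne_of_ne_zero k3
  have m4 := hA.ne_of_ne_zero k4
  rw [Finset.card_eq_of_equiv_fin (n := 4)] at hcard
  · have := Finset.card_le_three (a := x) (b := y) (c := z)
    omega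
  · have : #({a, b, c, d} : Finset V) = 4 := by
      simp [Finset.card_insert_of_notMem, m1, m2, m3, m4.symm, h.ne₁, h.ne₂]
    exact (Finset.equivFin _).trans (finCongr this)

end Cycles

/-! ### The fourth moment through degrees and 4-cycles -/

section Moments

variable {V : Type*}

theorem IsSignedAdj.sq_mul_sq {A : Matrix V V ℤ} (hA : IsSignedAdj A) (u v : V) :
    A u v ^ 2 * A u v ^ 2 = A u v ^ 2 := by
  rcases hA.entry u v with h | h | h <;> simp [h]

theorem fourCycleSum_term_le [DecidableEq V] {A : Matrix V V ℤ} (hA : IsSignedAdj A) (a b c d : V)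
    [Decidable (IsPositiveFourCycle A a b c d)] :
    (if a ≠ c ∧ b ≠ d then A a b * A b c * A c d * A d a else 0) ≤
      if IsPositiveFourCycle A a b c d then 1 else 0 := by
  have hle : A a b * A b c * A c d * A d a ≤ 1 := by
    rcases hA.entry a b with h1 | h1 | h1 <;> rcases hA.entry b c with h2 | h2 | h2 <;>
    rcases hA.entry c d with h3 | h3 | h3 <;> rcases hA.entry d a with h4 | h4 | h4 <;>
    simp [h1, h2, h3, h4]
  by_cases h : a ≠ c ∧ b ≠ d
  · rw [if_pos h]
    split_ifs with h'
    · exact hle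
    · have : A a b * A b c * A c d * A d a ≠ 1 := fun h1 => h' ⟨h.1, h.2, h1⟩
      omega
  · rw [if_neg h]
    split_ifs <;> simp

variable [Fintype V]

/-- The degree of the vertex `u`. -/
def vertexDeg (A : Matrix V V ℤ) (u : V) : ℤ := ∑ v, A u v ^ 2

/-- The fourth spectral moment `tr A⁴ = ‖A²‖²` of a symmetric matrix. -/
def quartic (A : Matrix V V ℤ) : ℤ := ∑ u, ∑ w, (∑ x, A u x * A x w) ^ 2

/-- The signed number of parametrized cycles of length four. -/
def fourCycleSum [DecidableEq V] (A : Matrix V V ℤ) : ℤ :=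
  ∑ t : V × V × V × V, if t.1 ≠ t.2.2.1 ∧ t.2.1 ≠ t.2.2.2 then
    A t.1 t.2.1 * A t.2.1 t.2.2.1 * A t.2.2.1 t.2.2.2 * A t.2.2.2 t.1 else 0

variable {A : Matrix V V ℤ}

/-- Inclusion–exclusion over closed walks `u x w y u`: those with `u = w` and those with `x = y`
each contribute `∑ d²`, those with both `∑ d`, and the remaining ones are the 4-cycles. -/
theorem quartic_eq [DecidableEq V] (hA : IsSignedAdj A) :
    quartic A = 2 * ∑ u, vertexDeg A u ^ 2 - ∑ u, vertexDeg A u + fourCycleSum A := by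
  have h1 : ∀ u, vertexDeg A u ^ 2 = ∑ x, ∑ y, A u x ^ 2 * A u y ^ 2 := by
    intro u
    rw [vertexDeg, sq, Finset.sum_mul_sum]
  have h2 : quartic A = ∑ u, ∑ x, ∑ w, ∑ y, A u x * A x w * A w y * A y u := by
    unfold quartic
    refine Finset.sum_congr rfl fun u _ => ?_
    rw [Finset.sum_comm]
    refine Finset.sum_congr rfl fun w _ => ?_
    rw [sq, Finset.sum_mul_sum]
    refine Finset.sum_congr rfl fun x _ => Finset.sum_congr rfl fun y _ => ?_
    rw [hA.symm w y, hA.symm y u]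
    ring
  have h3 : ∑ u, ∑ x, ∑ w, ∑ y, (if u = w then A u x * A x w * A w y * A y u else 0) =
      ∑ u, vertexDeg A u ^ 2 := by
    refine Finset.sum_congr rfl fun u _ => ?_
    rw [h1]
    refine Finset.sum_congr rfl fun x _ => ?_
    rw [Finset.sum_comm]
    refine Finset.sum_congr rfl fun y _ => ?_
    simp only [Finset.sum_ite_eq, Finset.mem_univ, if_true]
    rw [hA.symm x u, hA.symm y u]
    ring
  have h4 : ∑ u, ∑ x, ∑ w, ∑ y, (if x = y then A u x * A x w * A w y * A y u else 0) =
      ∑ u, vertexDeg A u ^ 2 := by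
    rw [Finset.sum_comm]
    refine Finset.sum_congr rfl fun x _ => ?_
    rw [h1]
    refine Finset.sum_congr rfl fun u _ => Finset.sum_congr rfl fun w _ => ?_
    simp only [Finset.sum_ite_eq, Finset.mem_univ, if_true]
    rw [hA.symm u x, hA.symm w x]
    ring
  have h5 : ∑ u, ∑ x, ∑ w, ∑ y, (if u = w then if x = y then
      A u x * A x w * A w y * A y u else 0 else 0) = ∑ u, vertexDeg A u := by
    refine Finset.sum_congr rfl fun u _ => Finset.sum_congr rfl fun x _ => ?_
    rw [Finset.sum_comm]
    simp only [Finset.sum_ite_eq, Finset.mem_univ, if_true]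
    rw [hA.symm x u, ← hA.sq_mul_sq u x]
    ring
  have h6 : fourCycleSum A = ∑ u, ∑ x, ∑ w, ∑ y, (if u ≠ w ∧ x ≠ y then
      A u x * A x w * A w y * A y u else 0) := by
    unfold fourCycleSum
    simp only [Fintype.sum_prod_type]
  rw [two_mul, h6, h2]
  nth_rewrite 1 [← h3]
  rw [← h4, ← h5]
  simp only [← Finset.sum_add_distrib, ← Finset.sum_sub_distrib]
  refine Finset.sum_congr rfl fun u _ => Finset.sum_congr rfl fun x _ =>
    Finset.sum_congr rfl fun w _ => Finset.sum_congr rfl fun y _ => ?_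
  by_cases huw : u = w <;> by_cases hxy : x = y <;> simp [huw, hxy]

theorem fourCycleSum_nonpos [DecidableEq V] (hA : IsSignedAdj A)
    (h : ∀ a b c d, ¬ IsPositiveFourCycle A a b c d) : fourCycleSum A ≤ 0 := by
  classical
  refine Finset.sum_nonpos fun t _ => (fourCycleSum_term_le hA _ _ _ _).trans ?_
  rw [if_neg (h _ _ _ _)]

/-- Negative cycles only lower the sum, and the positive ones are the eight parametrizations of a
single cycle. -/
theorem fourCycleSum_le_eight [DecidableEq V] (hA : IsUnbalancedBicyclic A) :
    fourCycleSum A ≤ 8 := by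
  classical
  by_cases h : ∀ a b c d, ¬ IsPositiveFourCycle A a b c d
  · exact (fourCycleSum_nonpos hA.toIsSignedAdj h).trans (by norm_num)
  push Not at h
  obtain ⟨a, b, c, d, h⟩ := h
  calc fourCycleSum A ≤ ∑ t : V × V × V × V,
        if IsPositiveFourCycle A t.1 t.2.1 t.2.2.1 t.2.2.2 then 1 else 0 :=
        Finset.sum_le_sum fun t _ => fourCycleSum_term_le hA.toIsSignedAdj _ _ _ _
    _ = #{t : V × V × V × V | IsPositiveFourCycle A t.1 t.2.1 t.2.2.1 t.2.2.2} := by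
        rw [Finset.sum_boole]
    _ ≤ #({(a, b, c, d), (b, c, d, a), (c, d, a, b), (d, a, b, c), (b, a, d, c), (a, d, c, b),
          (d, c, b, a), (c, b, a, d)} : Finset (V × V × V × V)) := by
        refine Nat.cast_le.2 (Finset.card_le_card ?_)
        rintro ⟨x, y, z, w⟩ ht
        simp only [Finset.mem_filter, Finset.mem_univ, true_and] at ht
        simp only [Finset.mem_insert, Finset.mem_singleton, Prod.mk.injEq]
        exact positiveFourCycle_cases hA h ht
    _ ≤ 8 := by 
        exact_mod_cast (Finset.card_insert_le _ _).trans (Nat.succ_le_succ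
          ((Finset.card_insert_le _ _).trans (Nat.succ_le_succ Finset.card_le_six)))

theorem fourCycleSum_nonpos_of_triangle [DecidableEq V] (hA : IsUnbalancedBicyclic A) {a b c : V}
    (h1 : A a b ≠ 0) (h2 : A b c ≠ 0) (h3 : A c a ≠ 0) : fourCycleSum A ≤ 0 := by
  -- If no triangle were positive, the vanishing sum `cubic` would consist of nonpositive terms, and
  -- the given triangle would be a nonzero one.
  have hpos : ∃ x y z, A x y * A y z * A z x = 1 := by
    by_contra! hno
    have hle : ∀ x y z, A x y * A y z * A z x ≤ 0 := by
      intro x y z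
      have := hno x y z
      rcases hA.entry x y with h1 | h1 | h1 <;> rcases hA.entry y z with h2 | h2 | h2 <;>
        rcases hA.entry z x with h3 | h3 | h3 <;> simp [h1, h2, h3] at this ⊢
    have hz := hA.cubic
    rw [Finset.sum_eq_zero_iff_of_nonpos fun x _ => Finset.sum_nonpos fun y _ =>
      Finset.sum_nonpos fun z _ => hle x y z] at hz
    have hz := hz a (Finset.mem_univ _)
    rw [Finset.sum_eq_zero_iff_of_nonpos fun y _ =>
      Finset.sum_nonpos fun z _ => hle a y z] at hz
    have hz := hz b (Finset.mem_univ _)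
    rw [Finset.sum_eq_zero_iff_of_nonpos fun z _ => hle a b z] at hz
    exact mul_ne_zero (mul_ne_zero h1 h2) h3 (hz c (Finset.mem_univ _))
  obtain ⟨x, y, z, h⟩ := hpos
  exact fourCycleSum_nonpos hA.toIsSignedAdj fun a b c d h' => threeCycle_ne_positive hA h' h

end Moments

/-! ### Deleting a pendant vertex -/

section Pendant

theorem IsSignedAdj.sq_eq_one {V : Type*} {A : Matrix V V ℤ} (hA : IsSignedAdj A) {u v : V} (h : A u v ≠ 0) : A u v ^ 2 = 1 := by
  rw [hA.sq_eq, if_pos h]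

theorem IsSignedAdj.submatrix {V W : Type*} {A : Matrix V V ℤ} (hA : IsSignedAdj A) {f : W → V} :
    IsSignedAdj (A.submatrix f f) where
  symm _ _ := hA.symm _ _
  diag _ := hA.diag _
  entry _ _ := hA.entry _ _

/-- The vertex `l` is pendant and attached to the vertex `p`. -/
structure IsPendant {V : Type*} (A : Matrix V V ℤ) (l p : V) : Prop where
  adj : A l p ≠ 0
  eq : ∀ x, A l x ≠ 0 → x = p

theorem IsPendant.exists_of_vertexDeg {V : Type*} [Fintype V] {A : Matrix V V ℤ} (hA : IsSignedAdj A) {l : V} (h : vertexDeg A l = 1) :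
    ∃ p, IsPendant A l p := by
  have h' : (#{v | A l v ≠ 0} : ℤ) = 1 := by
    rw [← h, vertexDeg]
    simp only [hA.sq_eq]
    rw [Finset.sum_boole]
  obtain ⟨p, hp⟩ := Finset.card_eq_one.1 (by exact_mod_cast h')
  refine ⟨p, ?_, fun x hx => ?_⟩
  · have : p ∈ ({v | A l v ≠ 0} : Finset V) := by rw [hp]; simp
    simpa using this
  · have : x ∈ ({v | A l v ≠ 0} : Finset V) := by simpa using hx
    simpa [hp] using this

variable {V : Type*} [Fintype V] [DecidableEq V] {A : Matrix V V ℤ}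

/-- The matrix of the signed graph with the vertex `l` deleted. -/
abbrev deleteVertex (A : Matrix V V ℤ) (l : V) : Matrix {x // x ≠ l} {x // x ≠ l} ℤ :=
  A.submatrix Subtype.val Subtype.val

theorem sum_eq_add_sum_ne {M : Type*} [AddCommMonoid M] (l : V) (f : V → M) :
    ∑ x, f x = f l + ∑ x : {x // x ≠ l}, f x := by
  rw [← Finset.add_sum_erase _ _ (Finset.mem_univ l)]
  congr 1
  rw [← Finset.sum_subtype (univ.erase l) (by simp) f]

theorem IsPendant.sum_mul (hA : IsSignedAdj A) {l p : V} (h : IsPendant A l p)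
    (f : {x // x ≠ l} → ℤ) :
    ∑ x : {x // x ≠ l}, A l x * f x = A l p * f ⟨p, (hA.ne_of_ne_zero h.adj).symm⟩ := by
  rw [Finset.sum_eq_single ⟨p, (hA.ne_of_ne_zero h.adj).symm⟩]
  · intro x _ hx
    have : A l x = 0 := by
      by_contra h0
      exact hx (Subtype.ext (h.eq _ h0))
    rw [this, zero_mul]
  · simp

theorem IsPendant.sum_sq (hA : IsSignedAdj A) {l p : V} (h : IsPendant A l p) :
    ∑ x : {x // x ≠ l}, A l x ^ 2 = 1 := by
  have := h.sum_mul hA fun x => A l x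
  simp only [← sq, hA.sq_eq_one h.adj] at this
  exact this

theorem IsPendant.vertexDeg_eq_one (hA : IsSignedAdj A) {l p : V} (h : IsPendant A l p) :
    vertexDeg A l = 1 := by
  rw [vertexDeg, sum_eq_add_sum_ne l, h.sum_sq hA, hA.diag]
  norm_num

theorem vertexDeg_deleteVertex (A : Matrix V V ℤ) (l : V) (x : {x // x ≠ l}) :
    vertexDeg (deleteVertex A l) x = vertexDeg A x - A x l ^ 2 := by
  rw [vertexDeg, vertexDeg, sum_eq_add_sum_ne l fun v => A x v ^ 2]
  simp

/-- With `d = d(p)`, compare the squared entries of `A²`: position `(l, l)` adds `1`, row and column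
`l` add `d - 1` each, and the entry at `(p, p)` grows from `d - 1` to `d`. All other entries are
unchanged. -/
theorem IsPendant.quartic_deleteVertex (hA : IsSignedAdj A) {l p : V} (h : IsPendant A l p) :
    quartic A = quartic (deleteVertex A l) + 4 * vertexDeg A p - 2 := by
  have hpl : p ≠ l := (hA.ne_of_ne_zero h.adj).symm
  set q : {x // x ≠ l} := ⟨p, hpl⟩ with hq
  have hAlp : A l p ^ 2 = 1 := hA.sq_eq_one h.adj
  have hll : ∑ x, A l x * A x l = 1 := by
    rw [← h.vertexDeg_eq_one hA, vertexDeg]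
    exact Finset.sum_congr rfl fun x _ => by rw [hA.symm x l, sq]
  have hlw : ∀ w : {x // x ≠ l}, ∑ x, A l x * A x w = A l p * A p w := by
    intro w
    rw [sum_eq_add_sum_ne l, hA.diag, zero_mul, zero_add]
    exact h.sum_mul hA fun x => A x w
  have hwl : ∀ w : {x // x ≠ l}, ∑ x, A w x * A x l = A l p * A p w := by
    intro w
    rw [← hlw]
    exact Finset.sum_congr rfl fun x _ => by rw [hA.symm w x, hA.symm x l, mul_comm]
  have huw : ∀ u w : {x // x ≠ l}, ∑ x, A u x * A x w = (if u = q ∧ w = q then 1 else 0) +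
      ∑ x : {x // x ≠ l}, deleteVertex A l u x * deleteVertex A l x w := by
    intro u w
    rw [sum_eq_add_sum_ne l]
    congr 1
    by_cases hu : A l u = 0
    · rw [hA.symm u l, hu, zero_mul, if_neg]
      rintro ⟨rfl, -⟩
      exact h.adj hu
    by_cases hw : A l w = 0
    · rw [hw, mul_zero, if_neg]
      rintro ⟨-, rfl⟩
      exact h.adj hw
    have hu' := h.eq _ hu
    have hw' := h.eq _ hw
    rw [if_pos ⟨Subtype.ext hu', Subtype.ext hw'⟩, hu', hw', hA.symm p l, ← sq, hAlp]
  have hqq : ∑ x : {x // x ≠ l}, deleteVertex A l q x * deleteVertex A l x q =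
      vertexDeg A p - 1 := by
    have := vertexDeg_deleteVertex A l q
    rw [hq, hA.symm, hAlp] at this
    rw [← this, vertexDeg]
    refine Finset.sum_congr rfl fun x _ => ?_
    change A p x * A x p = A p x ^ 2
    rw [hA.symm x p, sq]
  have hdp : ∑ w : {x // x ≠ l}, (A l p * A p w) ^ 2 = vertexDeg A p - 1 := by
    have := vertexDeg_deleteVertex A l q
    rw [hq, hA.symm, hAlp] at this
    rw [← this, vertexDeg]
    exact Finset.sum_congr rfl fun x _ => by rw [mul_pow, hAlp, one_mul]; rfl
  have hsq : ∀ u w : {x // x ≠ l}, (∑ x, A u x * A x w) ^ 2 =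
      (if u = q then if w = q then 1 + 2 * (vertexDeg A p - 1) else 0 else 0) +
      (∑ x : {x // x ≠ l}, deleteVertex A l u x * deleteVertex A l x w) ^ 2 := by
    intro u w
    rw [huw]
    by_cases hu : u = q
    · by_cases hw : w = q
      · rw [if_pos ⟨hu, hw⟩, if_pos hu, if_pos hw, hu, hw, hqq]
        ring
      · rw [if_neg fun h' => hw h'.2, if_pos hu, if_neg hw]
        ring
    · rw [if_neg fun h' => hu h'.1, if_neg hu]
      ring
  have hrow : ∀ u : {x // x ≠ l}, ∑ w, (∑ x, A u x * A x w) ^ 2 = (A l p * A p u) ^ 2 +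
      ((if u = q then 1 + 2 * (vertexDeg A p - 1) else 0) +
      ∑ w, (∑ x : {x // x ≠ l}, deleteVertex A l u x * deleteVertex A l x w) ^ 2) := by
    intro u
    rw [sum_eq_add_sum_ne l, hwl, Finset.sum_congr rfl fun w _ => hsq u w,
      Finset.sum_add_distrib]
    by_cases hu : u = q <;> simp [hu]
  unfold quartic
  rw [sum_eq_add_sum_ne l, sum_eq_add_sum_ne l, hll, Finset.sum_congr rfl fun u _ => hrow u,
    Finset.sum_congr rfl fun (w : {x // x ≠ l}) _ => by rw [hlw w], Finset.sum_add_distrib,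
    Finset.sum_add_distrib, hdp]
  simp only [Finset.sum_ite_eq', Finset.mem_univ, if_true]
  ring

theorem IsPendant.isUnbalancedBicyclic (hA : IsUnbalancedBicyclic A) {l p : V}
    (h : IsPendant A l p) : IsUnbalancedBicyclic (deleteVertex A l) where
  toIsSignedAdj := hA.toIsSignedAdj.submatrix
  conn := by
    classical
    have h1 : (supportGraph A).degree l = 1 := by
      have h2 := hA.toIsSignedAdj.sum_sq_eq_degree l
      have h3 := h.vertexDeg_eq_one hA.toIsSignedAdj
      rw [vertexDeg, h2] at h3
      exact_mod_cast h3
    have h2 := hA.conn.induce_compl_singleton_of_degree_eq_one h1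
    have h3 : supportGraph (deleteVertex A l) = SimpleGraph.induce {l}ᶜ (supportGraph A) := by
      ext x y
      rw [hA.toIsSignedAdj.submatrix.adj_iff]
      exact (hA.adj_iff _ _).symm
    rw [h3]
    exact h2
  size := by
    have h1 := hA.size
    rw [sum_eq_add_sum_ne l, sum_eq_add_sum_ne l, h.sum_sq hA.toIsSignedAdj, hA.diag] at h1
    simp_rw [sum_eq_add_sum_ne l fun v => A _ v ^ 2, Finset.sum_add_distrib] at h1
    have h2 : ∑ x : {x // x ≠ l}, A x l ^ 2 = 1 := by
      rw [← h.sum_sq hA.toIsSignedAdj]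
      exact Finset.sum_congr rfl fun x _ => by rw [hA.symm]
    have h3 : Fintype.card {x // x ≠ l} = Fintype.card V - 1 := by
      simp
    have h4 : 0 < Fintype.card V := Fintype.card_pos_iff.2 ⟨l⟩
    rw [h2] at h1
    rw [h3, Nat.cast_sub h4]
    simp only [Matrix.submatrix_apply]
    push_cast
    linarith
  unbalanced := by
    rintro θ ⟨h1, h2⟩
    have hpl : p ≠ l := (hA.toIsSignedAdj.ne_of_ne_zero h.adj).symm
    -- A potential of the smaller graph extends over `l`, its value there being forced by the only
    -- edge `lp`.
    apply hA.unbalanced fun x => if hx : x = l then A l p * θ ⟨p, hpl⟩ else θ ⟨x, hx⟩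
    have hlp := (hA.entry l p).resolve_left h.adj
    have hθp := h1 ⟨p, hpl⟩
    have key : ∀ v, A l v ≠ 0 → ∃ hv : v ≠ l, A l v = A l p * θ ⟨p, hpl⟩ * θ ⟨v, hv⟩ := by
      intro v hv
      obtain rfl := h.eq v hv
      refine ⟨hpl, ?_⟩
      rcases hθp with h3 | h3 <;> rw [h3] <;> ring
    refine ⟨fun u => ?_, fun u v huv => ?_⟩
    · by_cases hu : u = l
      · simp only [hu, dif_pos]
        rcases hlp with h3 | h3 <;> rcases hθp with h4 | h4 <;> simp [h3, h4]
      · simp only [hu, dif_neg, not_false_eq_true]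
        exact h1 _
    · by_cases hu : u = l
      · subst hu
        obtain ⟨hv, h3⟩ := key v huv
        simp only [hv, dif_pos, dif_neg, not_false_eq_true]
        exact h3
      · by_cases hv : v = l
        · subst hv
          rw [hA.symm] at huv ⊢
          obtain ⟨hu', h3⟩ := key u huv
          simp only [hu', dif_pos, dif_neg, not_false_eq_true]
          rw [h3, mul_comm]
        · simp only [hu, hv, dif_neg, not_false_eq_true]
          exact h2 ⟨u, hu⟩ ⟨v, hv⟩ huv
  cubic := by
    -- No triangle passes through a pendant vertex.
    have hz : ∀ v w, A l v * A v w * A w l = 0 := by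
      intro v w
      by_contra h0
      have hv : A l v ≠ 0 := fun h' => h0 (by rw [h']; ring)
      have hw : A l w ≠ 0 := fun h' => h0 (by rw [hA.symm w l, h']; ring)
      rw [h.eq v hv, h.eq w hw, hA.diag] at h0
      simp at h0
    have h1 := hA.cubic
    rw [sum_eq_add_sum_ne l] at h1
    simp only [hz, Finset.sum_const_zero, zero_add] at h1
    rw [← h1]
    refine Finset.sum_congr rfl fun u _ => ?_
    rw [sum_eq_add_sum_ne l]
    have h2 : ∀ w, A u l * A l w * A w u = 0 := fun w => by rw [← hz w u]; ring
    have h3 : ∀ v, A u v * A v l * A l u = 0 := fun v => by rw [← hz u v]; ring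
    simp only [h2, Finset.sum_const_zero, zero_add]
    refine Finset.sum_congr rfl fun v _ => ?_
    rw [sum_eq_add_sum_ne l, h3, zero_add]
    rfl

end Pendant

/-! ### Relabelling and switching -/

section Normalize

variable {V W : Type*} {A : Matrix V V ℤ}

theorem quartic_submatrix [Fintype V] [Fintype W] (A : Matrix V V ℤ) (e : W ≃ V) :
    quartic (A.submatrix e e) = quartic A := by
  simp only [quartic, Matrix.submatrix_apply]
  rw [← Equiv.sum_comp e]
  refine Finset.sum_congr rfl fun u _ => ?_
  rw [← Equiv.sum_comp e]
  refine Finset.sum_congr rfl fun w _ => ?_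
  rw [← Equiv.sum_comp e]

theorem vertexDeg_submatrix [Fintype V] [Fintype W] (A : Matrix V V ℤ) (e : W ≃ V) (w : W) :
    vertexDeg (A.submatrix e e) w = vertexDeg A (e w) := by
  simp only [vertexDeg, Matrix.submatrix_apply]
  rw [← Equiv.sum_comp e]

theorem IsUnbalancedBicyclic.submatrix [Fintype V] [Fintype W] (hA : IsUnbalancedBicyclic A)
    (e : W ≃ V) : IsUnbalancedBicyclic (A.submatrix e e) where
  toIsSignedAdj := hA.toIsSignedAdj.submatrix
  conn := by
    refine (SimpleGraph.Iso.connected_iff (H := supportGraph A) ⟨e, ?_⟩).2 hA.conn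
    intro a b
    rw [hA.adj_iff, hA.toIsSignedAdj.submatrix.adj_iff]
    rfl
  size := by
    rw [Fintype.card_congr e, ← hA.size, ← Equiv.sum_comp e]
    refine Finset.sum_congr rfl fun u _ => ?_
    rw [← Equiv.sum_comp e]
    rfl
  unbalanced := by
    rintro θ ⟨h1, h2⟩
    refine hA.unbalanced (θ ∘ e.symm) ⟨fun u => h1 _, fun u v h => ?_⟩
    have := h2 (e.symm u) (e.symm v)
    simp only [Matrix.submatrix_apply, Equiv.apply_symm_apply] at this
    exact this h
  cubic := by
    rw [← hA.cubic, ← Equiv.sum_comp e]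
    refine Finset.sum_congr rfl fun u _ => ?_
    rw [← Equiv.sum_comp e]
    refine Finset.sum_congr rfl fun v _ => ?_
    rw [← Equiv.sum_comp e]
    rfl

/-- The switching of `A` by the `±1`-valued function `θ`. -/
def switchMatrix (A : Matrix V V ℤ) (θ : V → ℤ) : Matrix V V ℤ :=
  Matrix.of fun u v => θ u * θ v * A u v

variable {θ : V → ℤ}

theorem pm_one_mul_self (hθ : ∀ u, θ u = 1 ∨ θ u = -1) (u : V) : θ u * θ u = 1 := by
  rcases hθ u with h | h <;> rw [h] <;> rfl

theorem quartic_switchMatrix (hθ : ∀ u, θ u = 1 ∨ θ u = -1) [Fintype V] (A : Matrix V V ℤ) :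
    quartic (switchMatrix A θ) = quartic A := by
  refine Finset.sum_congr rfl fun u _ => Finset.sum_congr rfl fun w _ => ?_
  have : ∀ x, switchMatrix A θ u x * switchMatrix A θ x w = θ u * θ w * (A u x * A x w) := by
    intro x
    simp only [switchMatrix, Matrix.of_apply]
    linear_combination (θ u * θ w * (A u x * A x w)) * pm_one_mul_self hθ x
  simp_rw [this]
  rw [← Finset.mul_sum, mul_pow]
  have h1 := pm_one_mul_self hθ u
  have h2 := pm_one_mul_self hθ w
  linear_combination (∑ x, A u x * A x w) ^ 2 * ((θ w) ^ 2 * h1 + h2)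

theorem IsSignedAdj.switch (hθ : ∀ u, θ u = 1 ∨ θ u = -1) 
    (hA : IsSignedAdj A) : IsSignedAdj (switchMatrix A θ) where
  symm u v := by simp only [switchMatrix, Matrix.of_apply, hA.symm v u]; ring
  diag u := by simp [switchMatrix, hA.diag]
  entry u v := by
    simp only [switchMatrix, Matrix.of_apply]
    rcases hθ u with h | h <;> rcases hθ v with h' | h' <;>
      rcases hA.entry u v with h'' | h'' | h'' <;> simp [h, h', h'']

theorem switchMatrix_eq_zero_iff (hθ : ∀ u, θ u = 1 ∨ θ u = -1) (u v : V) : switchMatrix A θ u v = 0 ↔ A u v = 0 := by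
  simp only [switchMatrix, Matrix.of_apply]
  rcases hθ u with h | h <;> rcases hθ v with h' | h' <;> simp [h, h']

theorem switchMatrix_sq (hθ : ∀ u, θ u = 1 ∨ θ u = -1) (u v : V) : switchMatrix A θ u v ^ 2 = A u v ^ 2 := by
  simp only [switchMatrix, Matrix.of_apply]
  rcases hθ u with h | h <;> rcases hθ v with h' | h' <;> simp [h, h']

theorem IsUnbalancedBicyclic.switch (hθ : ∀ u, θ u = 1 ∨ θ u = -1) [Fintype V] (hA : IsUnbalancedBicyclic A) :
    IsUnbalancedBicyclic (switchMatrix A θ) where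
  toIsSignedAdj := hA.toIsSignedAdj.switch hθ
  conn := by
    have : supportGraph (switchMatrix A θ) = supportGraph A := by
      ext u v
      rw [hA.adj_iff, (hA.toIsSignedAdj.switch hθ).adj_iff, not_iff_not]
      exact switchMatrix_eq_zero_iff hθ u v
    rw [this]
    exact hA.conn
  size := by
    simp only [switchMatrix_sq hθ]
    exact hA.size
  unbalanced := by
    rintro η ⟨h1, h2⟩
    refine hA.unbalanced (fun u => θ u * η u) ⟨fun u => ?_, fun u v h => ?_⟩
    · rcases hθ u with h | h <;> rcases h1 u with h' | h' <;> simp [h, h']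
    · have h3 := h2 u v (by rwa [Ne, switchMatrix_eq_zero_iff hθ])
      simp only [switchMatrix, Matrix.of_apply] at h3
      have h4 := pm_one_mul_self hθ u
      have h5 := pm_one_mul_self hθ v
      linear_combination θ u * θ v * h3 - A u v * ((θ v) ^ 2 * h4 + h5)
  cubic := by
    rw [← hA.cubic]
    refine Finset.sum_congr rfl fun u _ => Finset.sum_congr rfl fun v _ =>
      Finset.sum_congr rfl fun w _ => ?_
    simp only [switchMatrix, Matrix.of_apply]
    have h3 := pm_one_mul_self hθ u
    have h4 := pm_one_mul_self hθ v
    have h5 := pm_one_mul_self hθ w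
    linear_combination A u v * A v w * A w u * ((θ v) ^ 2 * (θ w) ^ 2 * h3 + (θ w) ^ 2 * h4 + h5)

/-- The symmetric group is `k`-transitive, so chosen vertices can be moved to the first labels. -/
theorem exists_equiv_extend [Fintype V] {n k : ℕ} (hn : Fintype.card V = n) (hk : k ≤ n)
    {f : Fin k → V} (hf : Function.Injective f) :
    ∃ e : Fin n ≃ V, ∀ i, e (Fin.castLE hk i) = f i := by
  have e₀ : Fin n ≃ V := (Fintype.equivFinOfCardEq hn).symm
  have := Equiv.Perm.isMultiplyPretransitive V k
  obtain ⟨g, hg⟩ := MulAction.exists_smul_eq (Equiv.Perm V)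
    ((Fin.castLEEmb hk).trans e₀.toEmbedding) (⟨f, hf⟩ : Fin k ↪ V)
  refine ⟨e₀.trans g, fun i => ?_⟩
  exact DFunLike.congr_fun hg i

end Normalize

/-! ### Exhaustive checks for orders four and five -/

section SmallCases

set_option maxRecDepth 100000 in
-- The variables are the entries `01, 02, 03, 12, 13, 23`. The hypotheses say that there are five
-- edges and that the triangle signs cancel; the left side of the conclusion is `quartic`.
theorem quartic_check_four : ∀ a ∈ [0, 1, -1], ∀ b ∈ [0, 1, -1], ∀ c ∈ [0, 1, -1],
    ∀ d ∈ [0, 1, -1], ∀ e ∈ [0, 1, -1], ∀ f ∈ [0, 1, -1],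
    a * a + b * b + c * c + d * d + e * e + f * f = 5 →
    a * d * b + a * e * c + b * f * c + d * f * e = 0 →
    (a * a + b * b + c * c) * (a * a + b * b + c * c) +
    (a * a + d * d + e * e) * (a * a + d * d + e * e) +
    (b * b + d * d + f * f) * (b * b + d * d + f * f) +
    (c * c + e * e + f * f) * (c * c + e * e + f * f) +
    2 * ((b * d + c * e) * (b * d + c * e) + (a * d + c * f) * (a * d + c * f) +
    (a * e + b * f) * (a * e + b * f) + (a * b + e * f) * (a * b + e * f) +
    (a * c + d * f) * (a * c + d * f) + (b * c + d * e) * (b * c + d * e)) ≤ (34 : ℤ) := by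
  decide

set_option maxRecDepth 100000 in
set_option synthInstance.maxHeartbeats 200000 in
set_option synthInstance.maxSize 1000 in
-- Vertex `0` is joined positively to exactly `2, 3, 4`, and the variables are the entries `12, 13,
-- 14, 23, 24, 34`. The hypotheses encode, in order: three further edges, cancelling triangles,
-- vertex `1` not isolated, degrees at most three, and failure of the potentials with value `1` off
-- vertex `1` and value `1` or `-1` there.
theorem quartic_check_five : ∀ a ∈ [0, 1, -1], ∀ b ∈ [0, 1, -1], ∀ c ∈ [0, 1, -1],
    ∀ d ∈ [0, 1, -1], ∀ e ∈ [0, 1, -1], ∀ f ∈ [0, 1, -1],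
    a * a + b * b + c * c + d * d + e * e + f * f = 3 →
    d + e + f + a * d * b + a * e * c + b * f * c + d * f * e = 0 →
    a * a + b * b + c * c ≠ 0 →
    a * a + d * d + e * e ≤ 2 → b * b + d * d + f * f ≤ 2 → c * c + e * e + f * f ≤ 2 →
    ¬ (a ≠ -1 ∧ b ≠ -1 ∧ c ≠ -1 ∧ d ≠ -1 ∧ e ≠ -1 ∧ f ≠ -1) →
    ¬ (a ≠ 1 ∧ b ≠ 1 ∧ c ≠ 1 ∧ d ≠ -1 ∧ e ≠ -1 ∧ f ≠ -1) →
    9 + (a * a + b * b + c * c) * (a * a + b * b + c * c) +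
    (a * a + d * d + e * e + 1) * (a * a + d * d + e * e + 1) +
    (b * b + d * d + f * f + 1) * (b * b + d * d + f * f + 1) +
    (c * c + e * e + f * f + 1) * (c * c + e * e + f * f + 1) +
    2 * ((b * d + c * e) * (b * d + c * e) + (a * d + c * f) * (a * d + c * f) +
    (a * e + b * f) * (a * e + b * f) + (1 + a * b + e * f) * (1 + a * b + e * f) +
    (1 + a * c + d * f) * (1 + a * c + d * f) + (1 + b * c + d * e) * (1 + b * c + d * e) +
    (a + b + c) * (a + b + c) + (d + e) * (d + e) + (d + f) * (d + f) + (e + f) * (e + f))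
    ≤ (44 : ℤ) := by
  decide

end SmallCases

/-! ### Fourth-moment bounds for orders four and five -/

section SmallOrder

variable {V : Type*} [Fintype V] {A : Matrix V V ℤ}

theorem IsSignedAdj.mem_list {V : Type*} {A : Matrix V V ℤ} (hA : IsSignedAdj A) (u v : V) :
    A u v ∈ [0, 1, -1] := by
  simpa using hA.entry u v

theorem IsUnbalancedBicyclic.quartic_le_of_card_eq_four (hA : IsUnbalancedBicyclic A)
    (hn : Fintype.card V = 4) : quartic A ≤ 34 := by
  have e : Fin 4 ≃ V := (Fintype.equivFinOfCardEq hn).symm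
  have hM := hA.submatrix e
  rw [← quartic_submatrix A e]
  generalize A.submatrix e e = M at hM
  have hs := hM.size
  have hc := hM.cubic
  simp only [Fin.sum_univ_four, Fintype.card_fin, hM.diag, hM.symm 1 0, hM.symm 2 0, hM.symm 3 0,
    hM.symm 2 1, hM.symm 3 1, hM.symm 3 2] at hs hc
  have hL := hM.toIsSignedAdj.mem_list
  have key := quartic_check_four (M 0 1) (hL _ _) (M 0 2) (hL _ _) (M 0 3) (hL _ _) (M 1 2)
    (hL _ _) (M 1 3) (hL _ _) (M 2 3) (hL _ _) (by push_cast at hs; linarith) (by linarith)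
  refine le_trans (le_of_eq ?_) key
  simp only [quartic, Fin.sum_univ_four, hM.diag, hM.symm 1 0, hM.symm 2 0, hM.symm 3 0,
    hM.symm 2 1, hM.symm 3 1, hM.symm 3 2]
  ring

theorem IsSignedAdj.sq_le_one {V : Type*} {A : Matrix V V ℤ} (hA : IsSignedAdj A) (u v : V) :
    A u v ^ 2 ≤ 1 := by
  rcases hA.entry u v with h | h | h <;> simp [h]

theorem IsUnbalancedBicyclic.exists_ne_zero [Nontrivial V] (hA : IsUnbalancedBicyclic A) (u : V) :
    ∃ v, A u v ≠ 0 := by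
  obtain ⟨v, hv⟩ := hA.conn.preconnected.exists_adj_of_nontrivial u
  exact ⟨v, (hA.adj_iff u v).1 hv⟩

theorem IsUnbalancedBicyclic.one_le_vertexDeg [Nontrivial V] (hA : IsUnbalancedBicyclic A)
    (u : V) : 1 ≤ vertexDeg A u := by
  obtain ⟨v, hv⟩ := hA.exists_ne_zero u
  rw [← hA.toIsSignedAdj.sq_eq_one hv]
  exact Finset.single_le_sum (fun w _ => sq_nonneg (A u w)) (Finset.mem_univ v)

theorem IsSignedAdj.vertexDeg_eq_card_sub [DecidableEq V] (hA : IsSignedAdj A) (u : V) :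
    vertexDeg A u = Fintype.card V - #{v | A u v = 0} := by
  have h1 : vertexDeg A u = #{v | A u v ≠ 0} := by
    rw [vertexDeg]
    simp only [hA.sq_eq]
    rw [Finset.sum_boole]
  have h2 := Finset.card_filter_add_card_filter_not (s := (univ : Finset V)) (fun v => A u v = 0)
  rw [h1, ← Finset.card_univ, ← h2]
  push_cast
  ring

/-- If `c` has exactly one non-neighbour, then there is a vertex `z` such that `c` is adjacent
exactly to the vertices other than `c` and `z`. -/
theorem IsSignedAdj.exists_nonadj [DecidableEq V] (hA : IsSignedAdj A) {c : V}
    (h : vertexDeg A c = Fintype.card V - 2) :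
    ∃ z, z ≠ c ∧ ∀ v, A c v = 0 ↔ v = c ∨ v = z := by
  have h1 := hA.vertexDeg_eq_card_sub c
  have h2 : #{v | A c v = 0} = 2 := by
    have : (#{v | A c v = 0} : ℤ) = 2 := by linarith
    exact_mod_cast this
  have hc : c ∈ ({v | A c v = 0} : Finset V) := by simpa using hA.diag c
  obtain ⟨x, y, hxy, h3⟩ := Finset.card_eq_two.1 h2
  have h4 : ∀ v, A c v = 0 ↔ v = x ∨ v = y := by
    intro v
    have : v ∈ ({v | A c v = 0} : Finset V) ↔ v ∈ ({x, y} : Finset V) := by rw [h3]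
    simpa using this
  rcases (h4 c).1 (hA.diag c) with rfl | rfl
  · exact ⟨y, hxy.symm, h4⟩
  · exact ⟨x, hxy, fun v => by rw [h4, or_comm]⟩

theorem IsSignedAdj.isPotential_five {N : Matrix (Fin 5) (Fin 5) ℤ} (hN : IsSignedAdj N)
    (n1 : N 0 1 = 0) (n2 : N 0 2 = 1) (n3 : N 0 3 = 1) (n4 : N 0 4 = 1) {η : ℤ}
    (hη : η = 1 ∨ η = -1) (p1 : N 1 2 ≠ -η) (p2 : N 1 3 ≠ -η) (p3 : N 1 4 ≠ -η)
    (p4 : N 2 3 ≠ -1) (p5 : N 2 4 ≠ -1) (p6 : N 3 4 ≠ -1) :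
    IsPotential N ![1, η, 1, 1, 1] := by
  have hη' : ∀ x : ℤ, (x = 0 ∨ x = 1 ∨ x = -1) → x ≠ -η → x ≠ 0 → x = η := by
    intro x; omega
  have h1' : ∀ x : ℤ, (x = 0 ∨ x = 1 ∨ x = -1) → x ≠ -1 → x ≠ 0 → x = 1 := by
    intro x; omega
  have hlt : ∀ u v, u < v → N u v ≠ 0 →
      N u v = (![1, η, 1, 1, 1] : Fin 5 → ℤ) u * (![1, η, 1, 1, 1] : Fin 5 → ℤ) v := by
    have q1 := hη' _ (hN.entry 1 2) p1
    have q2 := hη' _ (hN.entry 1 3) p2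
    have q3 := hη' _ (hN.entry 1 4) p3
    have q4 := h1' _ (hN.entry 2 3) p4
    have q5 := h1' _ (hN.entry 2 4) p5
    have q6 := h1' _ (hN.entry 3 4) p6
    simp only [Fin.forall_fin_succ]
    simp [n1, n2, n3, n4] at *
    exact ⟨⟨q1, q2, q3⟩, ⟨q4, q5⟩, q6⟩
  refine ⟨fun u => by fin_cases u <;> simp [hη], fun u v hne => ?_⟩
  rcases lt_trichotomy u v with h | h | h
  · exact hlt u v h hne
  · exact absurd (h ▸ hN.diag v) hne
  · rw [hN.symm] at hne ⊢
    rw [hlt v u h hne, mul_comm]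

theorem IsUnbalancedBicyclic.quartic_le_of_card_eq_five [DecidableEq V]
    (hA : IsUnbalancedBicyclic A) (hn : Fintype.card V = 5) (hd : ∀ u, vertexDeg A u ≤ 3) :
    quartic A ≤ 44 := by
  -- The degree sum is `12`, more than five vertices of degree at most two allow.
  obtain ⟨c, hc⟩ : ∃ c, vertexDeg A c = 3 := by
    by_contra! hno
    have h1 : ∑ u, vertexDeg A u ≤ ∑ _u : V, 2 := Finset.sum_le_sum fun u _ => by
      have := hd u
      have := hno u
      omega
    have h2 := hA.size
    simp only [vertexDeg] at h1
    rw [h2, Finset.sum_const, Finset.card_univ, hn] at h1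
    norm_num at h1
  obtain ⟨z, hz, hcz⟩ := hA.toIsSignedAdj.exists_nonadj (c := c) (by rw [hc, hn]; norm_num)
  have hinj : Function.Injective ![c, z] := by
    intro i j h
    fin_cases i <;> fin_cases j <;> simp_all [eq_comm]
  obtain ⟨e, he⟩ := exists_equiv_extend hn (by norm_num : 2 ≤ 5) hinj
  have he0 : e 0 = c := he 0
  have he1 : e 1 = z := he 1
  have hM := hA.submatrix e
  have hMd : ∀ u, vertexDeg (A.submatrix e e) u ≤ 3 := fun u => by
    rw [vertexDeg_submatrix]; exact hd _
  have hM0 : ∀ i, A.submatrix e e 0 i = 0 ↔ i = 0 ∨ i = 1 := by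
    intro i
    simp only [Matrix.submatrix_apply]
    rw [he0, hcz, ← he0, ← he1, e.injective.eq_iff, e.injective.eq_iff]
  rw [← quartic_submatrix A e]
  generalize A.submatrix e e = M at hM hMd hM0
  -- Switching by the signs of row `0` makes that row nonnegative; the default `1` applies at
  -- vertices `0` and `1`.
  let θ : Fin 5 → ℤ := fun i => if M 0 i = 0 then 1 else M 0 i
  have hθ : ∀ i, θ i = 1 ∨ θ i = -1 := by
    intro i
    by_cases h : M 0 i = 0
    · simp [θ, h]
    · simpa [θ, h] using (hM.entry 0 i).resolve_left h
  have hN := hM.switch hθ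
  have hN0 : ∀ i, switchMatrix M θ 0 i = if i = 0 ∨ i = 1 then 0 else 1 := by
    intro i
    by_cases h : M 0 i = 0
    · rw [if_pos ((hM0 i).1 h), switchMatrix_eq_zero_iff hθ, h]
    · rw [if_neg (fun h' => h ((hM0 i).2 h'))]
      have h1 := hM.toIsSignedAdj.sq_eq_one h
      simp only [switchMatrix, θ, Matrix.of_apply, hM.diag, if_true, h, if_false]
      linarith
  have hNd : ∀ u, vertexDeg (switchMatrix M θ) u ≤ 3 := by
    intro u
    simp only [vertexDeg, switchMatrix_sq hθ]
    exact hMd u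
  rw [← quartic_switchMatrix hθ]
  generalize switchMatrix M θ = N at hN hN0 hNd
  have n1 : N 0 1 = 0 := hN0 1
  have n2 : N 0 2 = 1 := hN0 2
  have n3 : N 0 3 = 1 := hN0 3
  have n4 : N 0 4 = 1 := hN0 4
  have hs := hN.size
  have hc := hN.cubic
  have d2 := hNd 2
  have d3 := hNd 3
  have d4 := hNd 4
  simp only [vertexDeg, Fin.sum_univ_five, Fintype.card_fin, hN.diag, hN.symm 1 0, hN.symm 2 0,
    hN.symm 3 0, hN.symm 4 0, hN.symm 2 1, hN.symm 3 1, hN.symm 3 2, hN.symm 4 1, hN.symm 4 2,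
    hN.symm 4 3, n1, n2, n3, n4] at hs hc d2 d3 d4
  have hL := hN.toIsSignedAdj.mem_list
  have hiso : N 1 2 * N 1 2 + N 1 3 * N 1 3 + N 1 4 * N 1 4 ≠ 0 := by
    obtain ⟨v, hv⟩ := hN.exists_ne_zero 1
    intro h0
    have h2 := mul_self_nonneg (N 1 2)
    have h3 := mul_self_nonneg (N 1 3)
    have h4 := mul_self_nonneg (N 1 4)
    have h2' : N 1 2 = 0 := mul_self_eq_zero.1 (by linarith)
    have h3' : N 1 3 = 0 := mul_self_eq_zero.1 (by linarith)
    have h4' : N 1 4 = 0 := mul_self_eq_zero.1 (by linarith)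
    fin_cases v
    · exact hv (by simpa [n1] using hN.symm 1 0)
    · exact hv (hN.diag 1)
    · exact hv h2'
    · exact hv h3'
    · exact hv h4'
  have hpot : ∀ η : ℤ, (η = 1 ∨ η = -1) → ¬ (N 1 2 ≠ -η ∧ N 1 3 ≠ -η ∧ N 1 4 ≠ -η ∧
      N 2 3 ≠ -1 ∧ N 2 4 ≠ -1 ∧ N 3 4 ≠ -1) := by
    rintro η hη ⟨p1, p2, p3, p4, p5, p6⟩
    exact hN.unbalanced _ (hN.toIsSignedAdj.isPotential_five n1 n2 n3 n4 hη p1 p2 p3 p4 p5 p6)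
  have key := quartic_check_five (N 1 2) (hL _ _) (N 1 3) (hL _ _) (N 1 4) (hL _ _) (N 2 3)
    (hL _ _) (N 2 4) (hL _ _) (N 3 4) (hL _ _) (by push_cast at hs; linarith) (by linarith) hiso
    (by linarith) (by linarith) (by linarith) (by simpa using hpot 1 (Or.inl rfl))
    (by simpa using hpot (-1) (Or.inr rfl))
  refine le_trans (le_of_eq ?_) key
  simp only [quartic, Fin.sum_univ_five, hN.diag, hN.symm 1 0, hN.symm 2 0,
    hN.symm 3 0, hN.symm 4 0, hN.symm 2 1, hN.symm 3 1, hN.symm 3 2, hN.symm 4 1, hN.symm 4 2,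
    hN.symm 4 3, n1, n2, n3, n4]
  ring

end SmallOrder

/-! ### Fourth-moment bounds without pendant vertices -/

section QuarticBound

variable {V : Type*} [Fintype V] {A : Matrix V V ℤ}

theorem IsUnbalancedBicyclic.sum_vertexDeg (hA : IsUnbalancedBicyclic A) : ∑ u, vertexDeg A u = 2 * (Fintype.card V : ℤ) + 2 := hA.size

theorem IsUnbalancedBicyclic.sum_excess (hA : IsUnbalancedBicyclic A) : ∑ u, (vertexDeg A u - 2) = 2 := by
  rw [Finset.sum_sub_distrib, hA.sum_vertexDeg, Finset.sum_const, Finset.card_univ,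
    nsmul_eq_mul]
  ring

theorem IsUnbalancedBicyclic.excess_add_le (hA : IsUnbalancedBicyclic A)
    (hd : ∀ u, 2 ≤ vertexDeg A u) {u v : V} (huv : u ≠ v) :
    vertexDeg A u + vertexDeg A v ≤ 6 := by
  classical
  have h := Finset.add_le_sum (s := univ) (f := fun u => vertexDeg A u - 2)
    (fun w _ => by have := hd w; linarith) (Finset.mem_univ u) (Finset.mem_univ v) huv
  rw [hA.sum_excess] at h
  linarith

theorem IsUnbalancedBicyclic.excess_le (hA : IsUnbalancedBicyclic A)
    (hd : ∀ u, 2 ≤ vertexDeg A u) (u : V) : vertexDeg A u ≤ 4 := by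
  have h := Finset.single_le_sum (s := univ) (f := fun u => vertexDeg A u - 2)
    (fun w _ => by have := hd w; linarith) (Finset.mem_univ u)
  rw [hA.sum_excess] at h
  linarith

/-- The excesses `d - 2` are nonnegative with sum two, so each satisfies `x² ≤ 2x`. -/
theorem IsUnbalancedBicyclic.sum_excess_sq_le (hA : IsUnbalancedBicyclic A)
    (hd : ∀ u, 2 ≤ vertexDeg A u) : ∑ u, (vertexDeg A u - 2) ^ 2 ≤ 4 := by
  calc ∑ u, (vertexDeg A u - 2) ^ 2 ≤ ∑ u, 2 * (vertexDeg A u - 2) :=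
        Finset.sum_le_sum fun u _ => by
          have h1 := hd u
          have h2 := hA.excess_le hd u
          nlinarith
    _ = 4 := by rw [← Finset.mul_sum, hA.sum_excess]; norm_num

theorem IsUnbalancedBicyclic.sum_excess_sq_le_two (hA : IsUnbalancedBicyclic A)
    (hd : ∀ u, 2 ≤ vertexDeg A u) (hd' : ∀ u, vertexDeg A u ≤ 3) :
    ∑ u, (vertexDeg A u - 2) ^ 2 ≤ 2 := by
  calc ∑ u, (vertexDeg A u - 2) ^ 2 ≤ ∑ u, (vertexDeg A u - 2) :=
        Finset.sum_le_sum fun u _ => by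
          have h1 := hd u
          have h2 := hd' u
          nlinarith
    _ = 2 := hA.sum_excess

variable [DecidableEq V]

theorem IsUnbalancedBicyclic.quartic_eq_excess (hA : IsUnbalancedBicyclic A) :
    quartic A = 2 * ∑ u, (vertexDeg A u - 2) ^ 2 + 6 * Fintype.card V + 14 + fourCycleSum A := by
  have h1 : ∑ u, (vertexDeg A u - 2) ^ 2 =
      ∑ u, vertexDeg A u ^ 2 - 4 * ∑ u, vertexDeg A u + 4 * Fintype.card V := by
    have : ∀ u, (vertexDeg A u - 2) ^ 2 = vertexDeg A u ^ 2 - 4 * vertexDeg A u + 4 := fun u => by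
      ring
    simp only [this, Finset.sum_add_distrib, Finset.sum_sub_distrib, ← Finset.mul_sum,
      Finset.sum_const, Finset.card_univ, nsmul_eq_mul]
    ring
  rw [quartic_eq hA.toIsSignedAdj, h1, hA.sum_vertexDeg]
  ring

/-- Without a triangle at `b`, its four neighbours can only reach degree two through the one
non-neighbour `z`. Then `z` also has degree at least four, which exceeds the total excess of two. -/
theorem IsUnbalancedBicyclic.exists_triangle_of_card_eq_six (hA : IsUnbalancedBicyclic A)
    (hn : Fintype.card V = 6) (hd : ∀ u, 2 ≤ vertexDeg A u) {b : V} (hb : vertexDeg A b = 4) :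
    ∃ x y, A b x ≠ 0 ∧ A x y ≠ 0 ∧ A y b ≠ 0 := by
  by_contra! hno
  obtain ⟨z, hz, hbz⟩ := hA.toIsSignedAdj.exists_nonadj (c := b) (by rw [hb, hn]; norm_num)
  have h1 : ∀ x, A b x ^ 2 ≤ A z x ^ 2 := by
    intro x
    by_cases hx : A b x = 0
    · rw [hx]
      simpa using sq_nonneg (A z x)
    have h2 : vertexDeg A x = A x b ^ 2 + A x z ^ 2 := by
      rw [vertexDeg, ← Finset.sum_pair (f := fun y => A x y ^ 2) hz.symm]
      refine (Finset.sum_subset (Finset.subset_univ _) fun y _ hy => ?_).symm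
      simp only [Finset.mem_insert, Finset.mem_singleton] at hy
      have hby : A b y ≠ 0 := fun h => hy ((hbz y).1 h)
      have hxy : A x y = 0 := by
        by_contra h
        exact hby ((hA.symm b y).trans (hno x y hx h))
      rw [hxy]
      norm_num
    have h3 := hd x
    have h4 := hA.toIsSignedAdj.sq_le_one x b
    have h5 := hA.toIsSignedAdj.sq_le_one b x
    rw [hA.symm z x]
    linarith
  have h2 : vertexDeg A b ≤ vertexDeg A z := Finset.sum_le_sum fun x _ => h1 x
  have h3 := hA.excess_add_le hd hz
  linarith

/-- The crude estimate `8 + 6n + 14 + 8` suffices from `n = 7` on. For `n = 6` it gives `66` instead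
of `62`: a vertex of degree four brings a triangle, which removes the last `8`, and otherwise the
degree term drops from `8` to `4`. -/
theorem IsUnbalancedBicyclic.quartic_le_of_two_le_vertexDeg (hA : IsUnbalancedBicyclic A)
    (hn : 6 ≤ Fintype.card V) (hd : ∀ u, 2 ≤ vertexDeg A u) :
    quartic A ≤ 2 * (Fintype.card V : ℤ) ^ 2 - 8 * Fintype.card V + 38 := by
  have h1 := hA.quartic_eq_excess
  have h2 := hA.sum_excess_sq_le hd
  have h3 := fourCycleSum_le_eight hA
  rcases hn.lt_or_eq with h7 | h6
  · have : (7 : ℤ) ≤ Fintype.card V := by exact_mod_cast h7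
    nlinarith
  · by_cases h4 : ∃ b, vertexDeg A b = 4
    · obtain ⟨b, hb⟩ := h4
      obtain ⟨x, y, hx, hy, hz⟩ := hA.exists_triangle_of_card_eq_six h6.symm hd hb
      have := fourCycleSum_nonpos_of_triangle hA hx hy hz
      rw [← h6] at h1 ⊢
      push_cast at *
      linarith
    · push Not at h4
      have := hA.sum_excess_sq_le_two hd fun u => by
        have := hA.excess_le hd u
        have := h4 u
        omega
      rw [← h6] at h1 ⊢
      push_cast at *
      linarith

theorem IsSignedAdj.ne_zero_of_vertexDeg_eq (hA : IsSignedAdj A) {c : V}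
    (hc : vertexDeg A c = Fintype.card V - 1) {v : V} (hv : v ≠ c) : A c v ≠ 0 := by
  intro h0
  have h1 := hA.vertexDeg_eq_card_sub c
  have h2 : (#{v | A c v = 0} : ℤ) = 1 := by linarith
  obtain ⟨w, hw⟩ := Finset.card_eq_one.1 (by exact_mod_cast h2)
  have h3 : ∀ x, A c x = 0 → x = w := by
    intro x hx
    have : x ∈ ({v | A c v = 0} : Finset V) := by simpa using hx
    simpa [hw] using this
  exact hv ((h3 v h0).trans (h3 c (hA.diag c)).symm)

/-- Any edge avoiding `c` closes a triangle with it, so the 4-cycle term is nonpositive and `8 + 30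
+ 14` remains. -/
theorem IsUnbalancedBicyclic.quartic_le_of_center (hA : IsUnbalancedBicyclic A)
    (hn : Fintype.card V = 5) (hd : ∀ u, 2 ≤ vertexDeg A u) {c : V} (hc : vertexDeg A c = 4) :
    quartic A ≤ 52 := by
  have hcv : ∀ v, v ≠ c → A c v ≠ 0 := fun v hv =>
    hA.toIsSignedAdj.ne_zero_of_vertexDeg_eq (by rw [hc, hn]; norm_num) hv
  obtain ⟨u, hu⟩ : ∃ u, u ≠ c := by
    have : Nontrivial V := Fintype.one_lt_card_iff_nontrivial.1 (by omega)
    exact exists_ne c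
  obtain ⟨v, hv, hvc⟩ : ∃ v, A u v ≠ 0 ∧ v ≠ c := by
    by_contra! hno
    have h1 : vertexDeg A u = A u c ^ 2 := by
      rw [vertexDeg]
      refine Finset.sum_eq_single c (fun v _ hv => ?_) (by simp)
      have : A u v = 0 := by
        by_contra h
        exact hv (hno v h)
      rw [this]
      norm_num
    have := hd u
    have := hA.toIsSignedAdj.sq_le_one u c
    omega
  have h1 := fourCycleSum_nonpos_of_triangle hA (hcv u hu) hv
    (by rw [hA.symm]; exact hcv v hvc)
  have h2 := hA.quartic_eq_excess
  have h3 := hA.sum_excess_sq_le hd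
  rw [hn] at h2
  push_cast at h2
  linarith

/-- Off the vertex `c` adjacent to all others there are only two edges. -/
theorem IsUnbalancedBicyclic.vertexDeg_le_three (hA : IsUnbalancedBicyclic A) {c : V}
    (hc : vertexDeg A c = Fintype.card V - 1) {u : V} (hu : u ≠ c) : vertexDeg A u ≤ 3 := by
  have hcv : ∀ v, v ≠ c → A v c ^ 2 = 1 := fun v hv => by
    rw [hA.symm]
    exact hA.toIsSignedAdj.sq_eq_one (hA.toIsSignedAdj.ne_zero_of_vertexDeg_eq hc hv)
  have hnn : ∀ v, v ≠ c → vertexDeg A v - 1 = ∑ w : {w // w ≠ c}, A v w ^ 2 := by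
    intro v hv
    rw [vertexDeg, sum_eq_add_sum_ne c, hcv v hv]
    ring
  have h1 : ∑ v : {v // v ≠ c}, (vertexDeg A v - 1) = 4 := by
    have h2 := hA.sum_vertexDeg
    rw [sum_eq_add_sum_ne c, hc] at h2
    rw [Finset.sum_sub_distrib, Finset.sum_const, Finset.card_univ]
    have h3 : Fintype.card {x // x ≠ c} = Fintype.card V - 1 := by simp
    have h4 : 0 < Fintype.card V := Fintype.card_pos_iff.2 ⟨c⟩
    rw [h3, nsmul_eq_mul, Nat.cast_sub h4]
    push_cast
    linarith
  have h2 : ∀ v : {v // v ≠ c}, (if v = ⟨u, hu⟩ then vertexDeg A u - 1 else 0) + A u v ^ 2 ≤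
      vertexDeg A v - 1 := by
    intro v
    split_ifs with h
    · rw [h, hA.diag]
      norm_num
    · rw [hnn v v.2, zero_add, hA.symm u v]
      exact Finset.single_le_sum (f := fun w : {w // w ≠ c} => A v w ^ 2)
        (fun w _ => sq_nonneg _) (Finset.mem_univ ⟨u, hu⟩)
  have h3 := Finset.sum_le_sum fun v (_ : v ∈ (univ : Finset {v // v ≠ c})) => h2 v
  rw [h1, Finset.sum_add_distrib, ← hnn u hu] at h3
  simp only [Finset.sum_ite_eq', Finset.mem_univ, if_true] at h3
  linarith

end QuarticBound

/-! ### Induction on the order by deleting pendant vertices -/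

section Induction

universe u

/-- Both alternatives are carried together because deleting a pendant vertex can turn a vertex of
degree `n - 2` into a centre. The values `2(n - 1)² + 20` and `2(n - 1)² + 16` are the fourth
moments of `Γ₁` and `Γ₂`. -/
theorem quartic_bounds (n : ℕ) : ∀ (V : Type u) [Fintype V] [DecidableEq V] (A : Matrix V V ℤ),
    IsUnbalancedBicyclic A → Fintype.card V = n →
    ((∀ c, vertexDeg A c ≤ n - 2) →
      quartic A ≤ 2 * (n : ℤ) ^ 2 - 8 * n + 38 ∧ (n = 5 → quartic A ≤ 44)) ∧
    (∀ c, vertexDeg A c = n - 1 → quartic A ≤ 2 * (n - 1 : ℤ) ^ 2 + 20 ∧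
      ((n = 4 ∨ ∃ u ≠ c, 3 ≤ vertexDeg A u) → quartic A ≤ 2 * (n - 1 : ℤ) ^ 2 + 16)) := by
  induction n using Nat.strong_induction_on with
  | _ n ih =>
  intro V _ _ A hA hn
  have hsum := hA.sum_vertexDeg
  rw [hn] at hsum
  have hmax : ∀ u, vertexDeg A u ≤ n - 1 := by
    intro u
    have h1 := hA.toIsSignedAdj.vertexDeg_eq_card_sub u
    have h2 : 0 < #{v | A u v = 0} := Finset.card_pos.2 ⟨u, by simpa using hA.diag u⟩
    have h3 : (1 : ℤ) ≤ #{v | A u v = 0} := by exact_mod_cast h2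
    rw [hn] at h1
    linarith
  have hbound : ∀ k : ℤ, (∀ u, vertexDeg A u ≤ k) → 2 * (n : ℤ) + 2 ≤ n * k := by
    intro k hk
    rw [← hsum]
    refine (Finset.sum_le_sum fun u _ => hk u).trans (le_of_eq ?_)
    rw [Finset.sum_const, Finset.card_univ, hn, nsmul_eq_mul]
  have hn4 : 4 ≤ n := by
    by_contra hlt
    have h1 := hbound _ hmax
    have h2 : (n : ℤ) ≤ 3 := by exact_mod_cast (by omega : n ≤ 3)
    have h3 : (0 : ℤ) ≤ n := by positivity
    nlinarith
  have hn4' : (4 : ℤ) ≤ n := by exact_mod_cast hn4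
  have hnt : Nontrivial V := Fintype.one_lt_card_iff_nontrivial.1 (by omega)
  by_cases h4 : n = 4
  · subst h4
    have h1 := hA.quartic_le_of_card_eq_four hn
    refine ⟨fun h => ?_, fun c _ => ?_⟩
    · have := hbound _ h
      norm_num at this
    · constructor
      · norm_num; linarith
      · intro _; norm_num; linarith
  have hn5 : 5 ≤ n := by omega
  have hn5' : (5 : ℤ) ≤ n := by exact_mod_cast hn5
  have hcast : ((n - 1 : ℕ) : ℤ) = n - 1 := by
    rw [Nat.cast_sub (by omega)]
    norm_num
  have hdel : ∀ l p, IsPendant A l p → IsUnbalancedBicyclic (deleteVertex A l) ∧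
      Fintype.card {x // x ≠ l} = n - 1 := fun l p hp => ⟨hp.isUnbalancedBicyclic hA, by
    simp [hn]⟩
  have hpend : (∀ u, 2 ≤ vertexDeg A u) ∨ ∃ l p, IsPendant A l p := by
    by_contra! hno
    obtain ⟨⟨l, hl⟩, hno⟩ := hno
    obtain ⟨p, hp⟩ := IsPendant.exists_of_vertexDeg hA.toIsSignedAdj
      (by have := hA.one_le_vertexDeg l; omega : vertexDeg A l = 1)
    exact hno l p hp
  constructor
  · intro hd
    by_cases h5 : n = 5
    · subst h5
      have := hA.quartic_le_of_card_eq_five hn (fun u => by have := hd u; norm_num at this; exact this)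
      exact ⟨by norm_num; linarith, fun _ => this⟩
    refine ⟨?_, fun h => absurd h h5⟩
    have hn6 : 6 ≤ n := by omega
    have hn6' : (6 : ℤ) ≤ n := by exact_mod_cast hn6
    rcases hpend with h2 | ⟨l, p, hp⟩
    · have := hA.quartic_le_of_two_le_vertexDeg (by omega) h2
      rwa [hn] at this
    obtain ⟨hB, hBn⟩ := hdel l p hp
    obtain ⟨ih1, ih2⟩ := ih (n - 1) (by omega) _ _ hB hBn
    have hq := hp.quartic_deleteVertex hA.toIsSignedAdj
    have hdp := hd p
    have hpl : p ≠ l := (hA.toIsSignedAdj.ne_of_ne_zero hp.adj).symm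
    have hdp' : vertexDeg (deleteVertex A l) ⟨p, hpl⟩ = vertexDeg A p - 1 := by
      rw [vertexDeg_deleteVertex, hA.symm, hA.toIsSignedAdj.sq_eq_one hp.adj]
    rw [hcast] at ih1 ih2
    -- Each case meets `2n² - 8n + 38` exactly: `2(n - 2)² + 16` with `d(p) = 4`, `2(n - 2)² + 20`
    -- with `d(p) ≤ 3`, and the inductive bound with `d(p) ≤ n - 2`.
    by_cases hc : ∃ c, vertexDeg (deleteVertex A l) c = n - 1 - 1
    · obtain ⟨c, hc⟩ := hc
      obtain ⟨h1, h2⟩ := ih2 c hc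
      have hpc : (⟨p, hpl⟩ : {x // x ≠ l}) ≠ c := by
        rintro rfl
        linarith
      have h3 := hB.vertexDeg_le_three (by rw [hc, hBn, hcast]) hpc
      by_cases h4 : 3 ≤ vertexDeg (deleteVertex A l) ⟨p, hpl⟩
      · have h5 := h2 (Or.inr ⟨_, hpc, h4⟩)
        nlinarith
      · have h6 : vertexDeg A p ≤ 3 := by omega
        nlinarith
    · have h1 : ∀ c, vertexDeg (deleteVertex A l) c ≤ n - 1 - 2 := by
        intro c
        have h2 : vertexDeg (deleteVertex A l) c ≤ n - 2 := by
          rw [vertexDeg_deleteVertex]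
          have := hd c
          have := sq_nonneg (A c l)
          linarith
        by_contra h3
        exact hc ⟨c, by omega⟩
      have h2 := (ih1 h1).1
      nlinarith
  · intro c hc
    rcases hpend with h2 | ⟨l, p, hp⟩
    · have h3 := hA.excess_le h2 c
      -- Without pendant vertices degrees are at most four, so a centre of degree `n - 1` forces
      -- order five.
      have h5 : n = 5 := by omega
      subst h5
      have h4 : vertexDeg A c = 4 := by rw [hc]; norm_num
      have h6 := hA.quartic_le_of_center hn h2 h4
      refine ⟨by norm_num; linarith, ?_⟩
      rintro (h | ⟨u, hu, hu3⟩)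
      · norm_num at h
      · have := hA.excess_add_le h2 hu
        omega
    obtain ⟨hB, hBn⟩ := hdel l p hp
    obtain ⟨-, ih2⟩ := ih (n - 1) (by omega) _ _ hB hBn
    have hq := hp.quartic_deleteVertex hA.toIsSignedAdj
    rw [hcast] at ih2
    have hl1 := hp.vertexDeg_eq_one hA.toIsSignedAdj
    have hlc : l ≠ c := by
      rintro rfl
      linarith
    have hpc : c = p := by
      apply hp.eq
      rw [hA.symm]
      exact hA.toIsSignedAdj.ne_zero_of_vertexDeg_eq (by rw [hc, hn]) hlc
    subst hpc
    have hdc : vertexDeg (deleteVertex A l) ⟨c, hlc.symm⟩ = n - 1 - 1 := by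
      rw [vertexDeg_deleteVertex, hA.symm, hA.toIsSignedAdj.sq_eq_one hp.adj, hc]
    obtain ⟨h1, h2⟩ := ih2 _ hdc
    refine ⟨by nlinarith, ?_⟩
    rintro (h | ⟨u, hu, hu3⟩)
    · exact absurd h h4
    · have hul : u ≠ l := by
        rintro rfl
        omega
      have hul0 : A u l = 0 := by
        by_contra h
        rw [hA.symm] at h
        exact hu (hp.eq u h)
      have := h2 (Or.inr ⟨⟨u, hul⟩, fun h => hu (congrArg Subtype.val h), by
        rw [vertexDeg_deleteVertex, hul0]
        linarith⟩)
      nlinarith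

end Induction

/-! ### Spectral moments and the pairing property -/

section Spectrum

variable {V : Type*} [Fintype V] [DecidableEq V]

theorem Matrix.IsHermitian.sum_eigenvalues_pow {A : Matrix V V ℝ} (hA : A.IsHermitian) (k : ℕ) :
    ∑ i, hA.eigenvalues i ^ k = (A ^ k).trace := by
  conv_rhs => rw [hA.spectral_theorem, ← map_pow, Unitary.conjStarAlgAut_apply,
    Matrix.trace_mul_cycle, Unitary.coe_star_mul_self, one_mul, Matrix.diagonal_pow,
    Matrix.trace_diagonal]
  simp

namespace SignedGraph

/-- The adjacency matrix with integer entries. -/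
noncomputable def intMatrix {V : Type*} (Γ : SignedGraph V) : Matrix V V ℤ :=
  open Classical in Matrix.of fun u v => if h : Γ.graph.Adj u v then (Γ.adjSign h : ℤ) else 0

section Basic

variable {V : Type*} (Γ : SignedGraph V)

theorem intMatrix_of_adj {u v : V} (h : Γ.graph.Adj u v) : Γ.intMatrix u v = Γ.adjSign h := by
  simp [intMatrix, h]

theorem intMatrix_of_not_adj {u v : V} (h : ¬ Γ.graph.Adj u v) : Γ.intMatrix u v = 0 := by
  simp [intMatrix, h]

theorem adjMatrix_apply (u v : V) : Γ.adjMatrix u v = Γ.intMatrix u v := by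
  simp only [adjMatrix, intMatrix, Matrix.of_apply]
  split_ifs <;> simp

theorem intMatrix_ne_zero_iff (u v : V) : Γ.intMatrix u v ≠ 0 ↔ Γ.graph.Adj u v := by
  by_cases h : Γ.graph.Adj u v
  · simp [intMatrix_of_adj, h]
  · simp [intMatrix_of_not_adj, h]

theorem isSignedAdj_intMatrix : IsSignedAdj Γ.intMatrix where
  symm u v := by
    by_cases h : Γ.graph.Adj u v
    · rw [Γ.intMatrix_of_adj h, Γ.intMatrix_of_adj h.symm, adjSign_symm]
    · rw [Γ.intMatrix_of_not_adj h, Γ.intMatrix_of_not_adj fun h' => h h'.symm]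
  diag u := Γ.intMatrix_of_not_adj (Γ.graph.loopless.irrefl u)
  entry u v := by
    by_cases h : Γ.graph.Adj u v
    · rw [Γ.intMatrix_of_adj h]
      rcases Int.units_eq_one_or (Γ.adjSign h) with h | h <;> simp [h]
    · exact Or.inl (Γ.intMatrix_of_not_adj h)

theorem supportGraph_intMatrix : supportGraph Γ.intMatrix = Γ.graph := by
  ext u v
  rw [Γ.isSignedAdj_intMatrix.adj_iff, intMatrix_ne_zero_iff]

/-- The product of edge signs telescopes, since interior vertices contribute squares of `±1`. -/
theorem walkSign_of_isPotential {θ : V → ℤ} (h : IsPotential Γ.intMatrix θ) {u v : V}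
    (p : Γ.graph.Walk u v) : (Γ.walkSign p : ℤ) = θ u * θ v := by
  induction p with
  | nil => simp [walkSign, pm_one_mul_self h.1]
  | @cons u v w hadj p ih =>
    rw [walkSign, Units.val_mul, ih, ← Γ.intMatrix_of_adj hadj,
      h.2 u v ((Γ.intMatrix_ne_zero_iff u v).2 hadj)]
    linear_combination (θ u * θ w) * pm_one_mul_self h.1 v

theorem balanced_of_isPotential {θ : V → ℤ} (h : IsPotential Γ.intMatrix θ) : Γ.Balanced := by
  intro v p _
  have := Γ.walkSign_of_isPotential h p
  rw [pm_one_mul_self h.1] at this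
  exact Units.ext this

theorem sum_intMatrix_sq [Fintype V] :
    ∑ u, ∑ v, Γ.intMatrix u v ^ 2 = 2 * (Γ.graph.edgeSet.ncard : ℤ) := by
  classical
  simp only [Γ.isSignedAdj_intMatrix.sum_sq_eq_degree]
  rw [← Nat.cast_sum, SimpleGraph.sum_degrees_eq_twice_card_edges, supportGraph_intMatrix,
    SimpleGraph.edgeFinset, ← Set.ncard_eq_toFinset_card']
  push_cast
  rfl

end Basic

variable (Γ : SignedGraph V)

theorem sum_eigenvalues_sq :
    ∑ i, Γ.eigenvalues i ^ 2 = ((∑ u, ∑ v, Γ.intMatrix u v ^ 2 : ℤ) : ℝ) := by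
  rw [eigenvalues, Γ.isHermitian_adjMatrix.sum_eigenvalues_pow, sq, Matrix.trace]
  push_cast
  refine Finset.sum_congr rfl fun u _ => Finset.sum_congr rfl fun v _ => ?_
  simp only [adjMatrix_apply, Γ.isSignedAdj_intMatrix.symm v u, sq]

theorem sum_eigenvalues_cube : ∑ i, Γ.eigenvalues i ^ 3 =
    ((∑ u, ∑ v, ∑ w, Γ.intMatrix u v * Γ.intMatrix v w * Γ.intMatrix w u : ℤ) : ℝ) := by
  rw [eigenvalues, Γ.isHermitian_adjMatrix.sum_eigenvalues_pow, pow_succ, sq, mul_assoc,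
    Matrix.trace]
  push_cast
  refine Finset.sum_congr rfl fun u _ => ?_
  rw [Matrix.diag_apply, Matrix.mul_apply]
  refine Finset.sum_congr rfl fun v _ => ?_
  rw [Matrix.mul_apply, Finset.mul_sum]
  refine Finset.sum_congr rfl fun w _ => ?_
  simp only [adjMatrix_apply]
  ring

theorem sum_eigenvalues_four : ∑ i, Γ.eigenvalues i ^ 4 = (quartic Γ.intMatrix : ℝ) := by
  rw [eigenvalues, Γ.isHermitian_adjMatrix.sum_eigenvalues_pow, (by norm_num : 4 = 2 + 2),
    pow_add, sq, Matrix.trace, quartic]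
  push_cast
  refine Finset.sum_congr rfl fun u _ => ?_
  rw [Matrix.diag_apply, Matrix.mul_apply]
  refine Finset.sum_congr rfl fun w _ => ?_
  have h : ∀ a b, (Γ.adjMatrix * Γ.adjMatrix) a b =
      ∑ x, (Γ.intMatrix a x : ℝ) * Γ.intMatrix x b := by
    intro a b
    simp only [Matrix.mul_apply, adjMatrix_apply]
  rw [h, h, sq]
  congr 1
  refine Finset.sum_congr rfl fun x _ => ?_
  rw [Γ.isSignedAdj_intMatrix.symm w x, Γ.isSignedAdj_intMatrix.symm x u, mul_comm]

theorem roots_charpoly : Γ.adjMatrix.charpoly.roots = univ.val.map Γ.eigenvalues :=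
  Γ.isHermitian_adjMatrix.roots_charpoly_eq_eigenvalues

variable {Γ}

theorem HasPairing.map_neg_eigenvalues (h : Γ.HasPairing) :
    univ.val.map (fun i => -Γ.eigenvalues i) = univ.val.map Γ.eigenvalues := by
  have h1 : univ.val.map (fun i => -Γ.eigenvalues i) =
      (univ.val.map Γ.eigenvalues).map (fun x => -x) := by
    rw [Multiset.map_map]
    rfl
  rw [h1, ← roots_charpoly]
  ext μ
  have h2 := Multiset.count_map_eq_count' (fun x : ℝ => -x) Γ.adjMatrix.charpoly.roots
    neg_injective (-μ)
  simp only [neg_neg] at h2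
  rw [h2, Polynomial.count_roots, Polynomial.count_roots]
  exact (h μ).symm

theorem HasPairing.sum_neg (h : Γ.HasPairing) (F : ℝ → ℝ) :
    ∑ i, F (-Γ.eigenvalues i) = ∑ i, F (Γ.eigenvalues i) := by
  have h1 := congrArg (fun s => (s.map F).sum) h.map_neg_eigenvalues
  simp only [Multiset.map_map] at h1
  exact h1

theorem HasPairing.exists_neg (h : Γ.HasPairing) (i : V) :
    ∃ j, Γ.eigenvalues j = -Γ.eigenvalues i := by
  have h1 : -Γ.eigenvalues i ∈ univ.val.map Γ.eigenvalues := by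
    rw [← h.map_neg_eigenvalues]
    exact Multiset.mem_map_of_mem (fun i => -Γ.eigenvalues i) (Finset.mem_univ i)
  simpa using h1

/-- Average the sums of `exp μ` and `exp (-μ)`, which agree by pairing. -/
theorem HasPairing.estradaIndex_eq (h : Γ.HasPairing) :
    Γ.estradaIndex = ∑ i, Real.cosh (Γ.eigenvalues i) := by
  have h1 := h.sum_neg Real.exp
  simp only [Real.cosh_eq, ← Finset.sum_div, Finset.sum_add_distrib, h1]
  rw [estradaIndex]
  ring

theorem HasPairing.sum_cube (h : Γ.HasPairing) : ∑ i, Γ.eigenvalues i ^ 3 = 0 := by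
  have h1 := h.sum_neg fun x => x ^ 3
  simp only [Odd.neg_pow (by decide : Odd 3), Finset.sum_neg_distrib] at h1
  linarith

theorem isUnbalancedBicyclic_intMatrix (hb : Γ.Bicyclic) (hu : ¬ Γ.Balanced)
    (hp : Γ.HasPairing) : IsUnbalancedBicyclic Γ.intMatrix where
  toIsSignedAdj := Γ.isSignedAdj_intMatrix
  conn := by
    rw [supportGraph_intMatrix]
    exact hb.1
  size := by
    rw [sum_intMatrix_sq, hb.2]
    push_cast
    ring
  unbalanced θ h := hu (Γ.balanced_of_isPotential h)
  cubic := by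
    have := Γ.sum_eigenvalues_cube
    rw [hp.sum_cube] at this
    exact_mod_cast this.symm

end SignedGraph

end Spectrum

/-! ### The power series of `cosh` beyond its quadratic term -/

section Tail

/-- The power series `∑ t ^ (k + 2) / (2 k + 4)!`, so that `cosh x = 1 + x² / 2 + coshTail (x²)`. -/
noncomputable def coshTail (t : ℝ) : ℝ := ∑' k : ℕ, t ^ (k + 2) / ((2 * (k + 2)).factorial : ℝ)

theorem hasSum_coshTail_sq (x : ℝ) :
    HasSum (fun k : ℕ => (x ^ 2) ^ (k + 2) / ((2 * (k + 2)).factorial : ℝ))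
      (Real.cosh x - (1 + x ^ 2 / 2)) := by
  have h := (hasSum_nat_add_iff' 2).2 (Real.hasSum_cosh x)
  simp only [Finset.sum_range_succ, Finset.sum_range_zero, pow_mul x 2] at h
  norm_num [Nat.factorial] at h
  exact h

theorem hasSum_coshTail {t : ℝ} (ht : 0 ≤ t) :
    HasSum (fun k : ℕ => t ^ (k + 2) / ((2 * (k + 2)).factorial : ℝ)) (coshTail t) := by
  have h := hasSum_coshTail_sq (√t)
  rw [Real.sq_sqrt ht] at h
  exact h.summable.hasSum

theorem cosh_eq_coshTail (x : ℝ) : Real.cosh x = 1 + x ^ 2 / 2 + coshTail (x ^ 2) := by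
  have := (hasSum_coshTail_sq x).unique (hasSum_coshTail (sq_nonneg x))
  linarith

theorem coshTail_nonneg {t : ℝ} (ht : 0 ≤ t) : 0 ≤ coshTail t :=
  (hasSum_coshTail ht).nonneg fun k => by positivity

theorem coshTail_zero : coshTail 0 = 0 := by
  simp [coshTail]

/-- Termwise comparison of sums of `coshTail`. -/
theorem sum_coshTail_lt {ι κ : Type*} (s : Finset ι) (r : Finset κ) {f : ι → ℝ} {g : κ → ℝ}
    (hf : ∀ i ∈ s, 0 ≤ f i) (hg : ∀ i ∈ r, 0 ≤ g i)
    (hle : ∀ k : ℕ, ∑ i ∈ s, f i ^ (k + 2) ≤ ∑ i ∈ r, g i ^ (k + 2))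
    (hlt : ∑ i ∈ s, f i ^ 2 < ∑ i ∈ r, g i ^ 2) :
    ∑ i ∈ s, coshTail (f i) < ∑ i ∈ r, coshTail (g i) := by
  have h1 := hasSum_sum fun i hi => hasSum_coshTail (hf i hi)
  have h2 := hasSum_sum fun i hi => hasSum_coshTail (hg i hi)
  refine hasSum_lt (i := 0) (fun k => ?_) ?_ h1 h2
  · simp only [← Finset.sum_div]
    gcongr
    exact hle k
  · simp only [← Finset.sum_div]
    gcongr

end Tail

namespace SignedGraph

/-! ### The Estrada index through even moments -/

section Estrada

variable {V : Type*} [Fintype V] [DecidableEq V] {Γ : SignedGraph V}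

/-- The first two terms of `cosh` contribute `n` and `(∑ μ²) / 2 = n + 1`. -/
theorem HasPairing.estradaIndex_eq_coshTail (h : Γ.HasPairing) (hb : Γ.Bicyclic) :
    Γ.estradaIndex = 2 * Fintype.card V + 1 + ∑ i, coshTail (Γ.eigenvalues i ^ 2) := by
  have h1 := Γ.sum_eigenvalues_sq
  rw [sum_intMatrix_sq, hb.2] at h1
  rw [h.estradaIndex_eq]
  simp only [cosh_eq_coshTail, Finset.sum_add_distrib, ← Finset.sum_div, h1, Finset.sum_const,
    Finset.card_univ, nsmul_eq_mul]
  push_cast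
  ring

/-- Comparison of the Estrada index with that of a spectrum `±√a, ±√b, 0, …, 0`. -/
theorem sum_coshTail_eigenvalues_lt {a b B C : ℝ} (ha : 0 ≤ a) (hb : 0 ≤ b)
    (hB : ∀ i, Γ.eigenvalues i ^ 2 ≤ B) (hC : ∑ i, Γ.eigenvalues i ^ 4 ≤ 2 * C)
    (hk : ∀ k : ℕ, C * B ^ k ≤ a ^ (k + 2) + b ^ (k + 2)) (h0 : C < a ^ 2 + b ^ 2) :
    ∑ i, coshTail (Γ.eigenvalues i ^ 2) < 2 * coshTail a + 2 * coshTail b := by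
  have key := sum_coshTail_lt (univ : Finset V) (univ : Finset (Fin 4))
    (f := fun i => Γ.eigenvalues i ^ 2) (g := ![a, a, b, b]) (fun i _ => sq_nonneg _)
    (fun i _ => by fin_cases i <;> simpa) (fun k => ?_) ?_
  · simp only [Fin.sum_univ_four] at key
    simp at key
    linarith
  · rw [Fin.sum_univ_four]
    simp
    -- Every higher moment is bounded by the fourth moment times a power of the largest squared
    -- eigenvalue.
    have : ∑ i, (Γ.eigenvalues i ^ 2) ^ (k + 2) ≤ ∑ i, Γ.eigenvalues i ^ 4 * B ^ k :=
      Finset.sum_le_sum fun i _ => by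
        rw [pow_add, ← pow_mul _ 2 2, mul_comm, (by norm_num : 2 * 2 = 4)]
        have := pow_le_pow_left₀ (sq_nonneg (Γ.eigenvalues i)) (hB i) k
        exact mul_le_mul_of_nonneg_left this (by positivity)
    rw [← Finset.sum_mul] at this
    rcases isEmpty_or_nonempty V with hV | ⟨⟨i⟩⟩
    · simp
      positivity
    have hB0 : 0 ≤ B ^ k := pow_nonneg ((sq_nonneg _).trans (hB i)) k
    have h2 := mul_le_mul_of_nonneg_right hC hB0
    have h3 := hk k
    linarith
  · rw [Fin.sum_univ_four]
    simp
    simp only [← pow_mul]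
    norm_num
    linarith

end Estrada

/-! ### Criteria for imbalance, eigenvalues, pairing and bicyclicity -/

section Criteria

variable {V : Type*} [Fintype V] [DecidableEq V] {Γ : SignedGraph V}

theorem not_balanced_of_triangle {V : Type*} {Γ : SignedGraph V} {a b c : V}
    (h : Γ.intMatrix a b * Γ.intMatrix b c * Γ.intMatrix c a = -1) : ¬ Γ.Balanced := by
  intro hbal
  have h1 : Γ.intMatrix a b ≠ 0 := by intro h0; simp [h0] at h
  have h2 : Γ.intMatrix b c ≠ 0 := by intro h0; simp [h0] at h
  have h3 : Γ.intMatrix c a ≠ 0 := by intro h0; simp [h0] at h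
  rw [intMatrix_ne_zero_iff] at h1 h2 h3
  have hp := hbal a (.cons h1 (.cons h2 (.cons h3 .nil))) (by
    simp [SimpleGraph.Walk.isCycle_def, h1.ne, h2.ne, h3.ne, h1.ne.symm, h3.ne.symm])
  rw [Γ.intMatrix_of_adj h1, Γ.intMatrix_of_adj h2, Γ.intMatrix_of_adj h3] at h
  have hp' := congrArg (fun s : ℤˣ => (s : ℤ)) hp
  simp only [walkSign, mul_one, Units.val_mul, Units.val_one] at hp'
  rw [mul_assoc, hp'] at h
  norm_num at h

theorem exists_eigenvalues_eq {μ : ℝ} {x : V → ℝ} (hx : x ≠ 0)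
    (h : ∀ i, ∑ j, (Γ.intMatrix i j : ℝ) * x j = μ * x i) : ∃ i, Γ.eigenvalues i = μ := by
  have h1 : Module.End.HasEigenvalue (Matrix.toLin' Γ.adjMatrix) μ := by
    refine Module.End.hasEigenvalue_of_hasEigenvector (x := x) ⟨?_, hx⟩
    rw [Module.End.mem_eigenspace_iff]
    funext i
    simp only [Matrix.toLin'_apply, Matrix.mulVec, dotProduct, adjMatrix_apply, h, Pi.smul_apply,
      smul_eq_mul]
  have h2 : μ ∈ spectrum ℝ Γ.adjMatrix := by
    rw [← Matrix.spectrum_toLin']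
    exact h1.mem_spectrum
  rw [Γ.isHermitian_adjMatrix.spectrum_real_eq_range_eigenvalues] at h2
  exact h2

theorem charpoly_neg_adjMatrix :
    (-Γ.adjMatrix).charpoly = ∏ i, (Polynomial.X - Polynomial.C (-Γ.eigenvalues i)) := by
  refine Polynomial.funext fun μ => ?_
  have h := congrArg (Polynomial.eval (-μ)) Γ.isHermitian_adjMatrix.charpoly_eq
  rw [Matrix.eval_charpoly, Polynomial.eval_prod] at h
  rw [Matrix.eval_charpoly, Polynomial.eval_prod]
  have h1 : Matrix.scalar V μ - -Γ.adjMatrix = -(Matrix.scalar V (-μ) - Γ.adjMatrix) := by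
    rw [map_neg]
    abel
  rw [h1, Matrix.det_neg, h, ← Finset.card_univ, ← Finset.prod_const, ← Finset.prod_mul_distrib]
  refine Finset.prod_congr rfl fun i _ => ?_
  simp [eigenvalues]
  ring

/-- A signed graph that is isomorphic, up to switching, to its negative has the pairing
property. -/
theorem hasPairing_of_neg_eq (σ : Equiv.Perm V) {θ : V → ℤ} (hθ : ∀ i, θ i = 1 ∨ θ i = -1)
    (h : ∀ i j, -Γ.intMatrix i j = θ i * θ j * Γ.intMatrix (σ i) (σ j)) : Γ.HasPairing := by
  let D : Matrix V V ℝ := Matrix.diagonal fun i => (θ i : ℝ)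
  have hD : D * D = 1 := by
    rw [Matrix.diagonal_mul_diagonal, ← Matrix.diagonal_one]
    congr 1
    funext i
    exact_mod_cast pm_one_mul_self hθ i
  -- Since `D² = 1`, this makes `-A` similar to a relabelling of `A`, so the two have the same
  -- characteristic polynomial.
  have h1 : -Γ.adjMatrix = D * (Matrix.reindex σ.symm σ.symm Γ.adjMatrix) * D := by
    ext i j
    simp only [D, Matrix.mul_diagonal, Matrix.diagonal_mul, Matrix.reindex_apply,
      Matrix.submatrix_apply, Matrix.neg_apply, adjMatrix_apply, Equiv.symm_symm]
    have := congrArg (Int.cast : ℤ → ℝ) (h i j)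
    push_cast at this
    linarith
  have h2 : (-Γ.adjMatrix).charpoly = Γ.adjMatrix.charpoly := by
    rw [h1, Matrix.mul_assoc, Matrix.charpoly_mul_comm, Matrix.mul_assoc, hD, Matrix.mul_one,
      Matrix.charpoly_reindex]
  have h3 : Γ.adjMatrix.charpoly.roots = Γ.adjMatrix.charpoly.roots.map fun x => -x := by
    conv_lhs => rw [← h2, charpoly_neg_adjMatrix,
      Polynomial.roots_prod _ _ (Finset.prod_ne_zero_iff.2 fun i _ => Polynomial.X_sub_C_ne_zero _)]
    simp only [Polynomial.roots_X_sub_C, Multiset.bind_singleton]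
    rw [roots_charpoly, Multiset.map_map]
    rfl
  intro μ
  rw [multiplicity, multiplicity, ← Polynomial.count_roots, ← Polynomial.count_roots]
  conv_lhs => rw [h3]
  have := Multiset.count_map_eq_count' (fun x : ℝ => -x) Γ.adjMatrix.charpoly.roots
    neg_injective (-μ)
  simpa using this

theorem bicyclic_of_sum_sq [Nonempty V] (r : V) (hr : ∀ v, v ≠ r → Γ.intMatrix r v ≠ 0)
    (hs : ∑ u, ∑ v, Γ.intMatrix u v ^ 2 = 2 * (Fintype.card V : ℤ) + 2) : Γ.Bicyclic := by
  constructor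
  · have h1 : ∀ v, Γ.graph.Reachable r v := by
      intro v
      by_cases hv : v = r
      · rw [hv]
      · exact ((Γ.intMatrix_ne_zero_iff r v).1 (hr v hv)).reachable
    exact ⟨fun u v => (h1 u).symm.trans (h1 v)⟩
  · rw [sum_intMatrix_sq] at hs
    omega

end Criteria

/-! ### Membership of the two extremal graphs -/

section Gamma

theorem sum_fin_add_five {M : Type*} [AddCommMonoid M] (k : ℕ) (F : ℕ → M) :
    ∑ j : Fin (k + 5), F j =
      F 0 + F 1 + F 2 + F 3 + F 4 + ∑ j ∈ Finset.range k, F (j + 5) := by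
  rw [Fin.sum_univ_eq_sum_range, add_comm k 5, Finset.sum_range_add]
  simp only [Finset.sum_range_succ, Finset.sum_range_zero, zero_add, add_comm 5]

theorem nat_cases_five (a : ℕ) : a = 0 ∨ a = 1 ∨ a = 2 ∨ a = 3 ∨ a = 4 ∨ ∃ m, a = m + 5 := by
  rcases lt_or_ge a 5 with h | h
  · omega
  · exact Or.inr (Or.inr (Or.inr (Or.inr (Or.inr ⟨a - 5, by omega⟩))))

/-- The adjacency matrix of `gamma₁`, indexed by natural numbers. -/
def gammaEntry₁ (a b : ℕ) : ℤ :=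
  if a = b then 0 else if a = 0 ∨ b = 0 then 1 else
  if (a = 1 ∧ b = 2) ∨ (a = 2 ∧ b = 1) then -1 else
  if (a = 3 ∧ b = 4) ∨ (a = 4 ∧ b = 3) then 1 else 0

/-- The adjacency matrix of `gamma₂`, indexed by natural numbers. -/
def gammaEntry₂ (a b : ℕ) : ℤ :=
  if a = b then 0 else if a = 0 ∨ b = 0 then 1 else
  if (a = 1 ∧ b = 3) ∨ (a = 3 ∧ b = 1) then -1 else
  if (a = 1 ∧ b = 2) ∨ (a = 2 ∧ b = 1) then 1 else 0

theorem intMatrix_gamma₁ (n : ℕ) (i j : Fin n) :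
    (gamma₁ n).intMatrix i j = gammaEntry₁ i j := by
  by_cases h : (gamma₁ n).graph.Adj i j
  · rw [intMatrix_of_adj _ h]
    simp only [adjSign, gamma₁, Sym2.map_mk, Sym2.eq_iff]
    simp only [gamma₁, SimpleGraph.fromRel_adj, ne_eq, Fin.ext_iff] at h
    unfold gammaEntry₁
    split_ifs <;> first | rfl | (exfalso; omega)
  · rw [intMatrix_of_not_adj _ h]
    simp only [gamma₁, SimpleGraph.fromRel_adj, ne_eq, Fin.ext_iff] at h
    unfold gammaEntry₁
    split_ifs <;> first | rfl | (exfalso; omega)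

theorem intMatrix_gamma₂ (n : ℕ) (i j : Fin n) :
    (gamma₂ n).intMatrix i j = gammaEntry₂ i j := by
  by_cases h : (gamma₂ n).graph.Adj i j
  · rw [intMatrix_of_adj _ h]
    simp only [adjSign, gamma₂, Sym2.map_mk, Sym2.eq_iff]
    simp only [gamma₂, SimpleGraph.fromRel_adj, ne_eq, Fin.ext_iff] at h
    unfold gammaEntry₂
    split_ifs <;> first | rfl | (exfalso; omega)
  · rw [intMatrix_of_not_adj _ h]
    simp only [gamma₂, SimpleGraph.fromRel_adj, ne_eq, Fin.ext_iff] at h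
    unfold gammaEntry₂
    split_ifs <;> first | rfl | (exfalso; omega)

theorem bicyclic_gamma₁ (k : ℕ) : (gamma₁ (k + 5)).Bicyclic := by
  refine bicyclic_of_sum_sq 0 (fun v hv => ?_) ?_
  · rw [intMatrix_gamma₁]
    have : (v : ℕ) ≠ 0 := fun h => hv (Fin.ext h)
    simp [gammaEntry₁, this.symm]
  · simp only [intMatrix_gamma₁]
    rw [sum_fin_add_five k fun a => ∑ j : Fin (k + 5), gammaEntry₁ a j ^ 2]
    simp only [fun a => sum_fin_add_five k fun b => gammaEntry₁ a b ^ 2]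
    simp [gammaEntry₁]
    ring

theorem bicyclic_gamma₂ (k : ℕ) : (gamma₂ (k + 5)).Bicyclic := by
  refine bicyclic_of_sum_sq 0 (fun v hv => ?_) ?_
  · rw [intMatrix_gamma₂]
    have : (v : ℕ) ≠ 0 := fun h => hv (Fin.ext h)
    simp [gammaEntry₂, this.symm]
  · simp only [intMatrix_gamma₂]
    rw [sum_fin_add_five k fun a => ∑ j : Fin (k + 5), gammaEntry₂ a j ^ 2]
    simp only [fun a => sum_fin_add_five k fun b => gammaEntry₂ a b ^ 2]
    simp [gammaEntry₂]
    ring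

theorem not_balanced_gamma₁ (k : ℕ) : ¬ (gamma₁ (k + 5)).Balanced := by
  refine not_balanced_of_triangle (a := ⟨0, by omega⟩) (b := ⟨1, by omega⟩) (c := ⟨2, by omega⟩) ?_
  simp [intMatrix_gamma₁, gammaEntry₁]

theorem not_balanced_gamma₂ (k : ℕ) : ¬ (gamma₂ (k + 5)).Balanced := by
  refine not_balanced_of_triangle (a := ⟨0, by omega⟩) (b := ⟨1, by omega⟩) (c := ⟨3, by omega⟩) ?_
  simp [intMatrix_gamma₂, gammaEntry₂]

theorem hasPairing_gamma₁ (k : ℕ) : (gamma₁ (k + 5)).HasPairing := by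
  -- Exchanging the two triangles and switching at the centre negates all signs.
  let s : ℕ → ℕ := fun a =>
    if a = 1 then 3 else if a = 3 then 1 else if a = 2 then 4 else if a = 4 then 2 else a
  have hs : ∀ a, s (s a) = a := by
    intro a
    simp only [s]
    split_ifs <;> omega
  have hlt : ∀ a, a < k + 5 → s a < k + 5 := by
    intro a
    simp only [s]
    split_ifs <;> omega
  let f : Fin (k + 5) → Fin (k + 5) := fun i => ⟨s i, hlt i i.2⟩
  have hf : Function.Involutive f := fun i => Fin.ext (hs i)
  refine hasPairing_of_neg_eq (hf.toPerm) (θ := fun i => if i.val = 0 then -1 else 1)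
    (fun i => by split_ifs <;> simp) fun i j => ?_
  simp only [intMatrix_gamma₁, Function.Involutive.coe_toPerm, f]
  generalize (i : ℕ) = a
  generalize (j : ℕ) = b
  rcases nat_cases_five a with rfl | rfl | rfl | rfl | rfl | ⟨a, rfl⟩ <;>
    rcases nat_cases_five b with rfl | rfl | rfl | rfl | rfl | ⟨b, rfl⟩ <;>
    simp [s, gammaEntry₁]

theorem hasPairing_gamma₂ (k : ℕ) : (gamma₂ (k + 5)).HasPairing := by
  -- Exchanging the two vertices off the shared edge and switching at `0` negates all signs.
  let s : ℕ → ℕ := fun a => if a = 2 then 3 else if a = 3 then 2 else a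
  have hs : ∀ a, s (s a) = a := by
    intro a
    simp only [s]
    split_ifs <;> omega
  have hlt : ∀ a, a < k + 5 → s a < k + 5 := by
    intro a
    simp only [s]
    split_ifs <;> omega
  let f : Fin (k + 5) → Fin (k + 5) := fun i => ⟨s i, hlt i i.2⟩
  have hf : Function.Involutive f := fun i => Fin.ext (hs i)
  refine hasPairing_of_neg_eq (hf.toPerm) (θ := fun i => if i.val = 0 then -1 else 1)
    (fun i => by split_ifs <;> simp) fun i j => ?_
  simp only [intMatrix_gamma₂, Function.Involutive.coe_toPerm, f]
  generalize (i : ℕ) = a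
  generalize (j : ℕ) = b
  rcases nat_cases_five a with rfl | rfl | rfl | rfl | rfl | ⟨a, rfl⟩ <;>
    rcases nat_cases_five b with rfl | rfl | rfl | rfl | rfl | ⟨b, rfl⟩ <;>
    simp [s, gammaEntry₂]

end Gamma

/-! ### Spectra of the two extremal graphs -/

section GammaSpectrum

theorem exists_eigenvalues_gamma₁ (k : ℕ) {μ : ℝ} (hμ : 0 < μ)
    (h : (μ ^ 2) ^ 2 - (k + 5) * μ ^ 2 + k = 0) : ∃ i, (gamma₁ (k + 5)).eigenvalues i = μ := by
  -- The eigenvalue equations off the centre give `x₀ / (μ + 1)` on the negative triangle, `x₀ / (μ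
  -- - 1)` on the positive one and `x₀ / μ` on pendant vertices; `x₀` clears the denominators. The
  -- equation at the centre is then `h`.
  let x : ℕ → ℝ := fun a => if a = 0 then μ * (μ ^ 2 - 1) else if a = 1 ∨ a = 2 then μ ^ 2 - μ else
    if a = 3 ∨ a = 4 then μ ^ 2 + μ else μ ^ 2 - 1
  refine exists_eigenvalues_eq (x := fun i => x i) (fun h0 => ?_) fun i => ?_
  · have := congrFun h0 ⟨3, by omega⟩
    simp [x] at this
    nlinarith
  · simp only [intMatrix_gamma₁]
    rw [sum_fin_add_five k fun b => (gammaEntry₁ i b : ℝ) * x b]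
    generalize (i : ℕ) = a
    rcases nat_cases_five a with rfl | rfl | rfl | rfl | rfl | ⟨a, rfl⟩ <;>
      simp [x, gammaEntry₁]
    · linear_combination -h
    all_goals ring

theorem exists_eigenvalues_gamma₂ (k : ℕ) {μ : ℝ} (hμ : 0 < μ)
    (h : (μ ^ 2) ^ 2 - (k + 6) * μ ^ 2 + (2 * k + 6) = 0) :
    ∃ i, (gamma₂ (k + 5)).eigenvalues i = μ := by
  let x : ℕ → ℝ := fun a => if a = 0 then μ * (μ ^ 2 - 2) else if a = 1 then μ ^ 2 else
    if a = 2 then μ ^ 2 - 2 + μ else if a = 3 then μ ^ 2 - 2 - μ else μ ^ 2 - 2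
  refine exists_eigenvalues_eq (x := fun i => x i) (fun h0 => ?_) fun i => ?_
  · have := congrFun h0 ⟨1, by omega⟩
    simp [x] at this
    exact hμ.ne' this
  · simp only [intMatrix_gamma₂]
    rw [sum_fin_add_five k fun b => (gammaEntry₂ i b : ℝ) * x b]
    generalize (i : ℕ) = a
    rcases nat_cases_five a with rfl | rfl | rfl | rfl | rfl | ⟨a, rfl⟩ <;>
      simp [x, gammaEntry₂]
    · linear_combination -h
    all_goals ring

/-- Only the pair `±√t` is kept; the other eigenvalues contribute nonnegatively. -/
theorem estradaIndex_gamma₁_ge (k : ℕ) {t : ℝ} (ht : 0 < t) (h : t ^ 2 - (k + 5) * t + k = 0) :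
    2 * (k + 5 : ℝ) + 1 + 2 * coshTail t ≤ (gamma₁ (k + 5)).estradaIndex := by
  have hs : 0 < √t := Real.sqrt_pos.2 ht
  have hs2 : √t ^ 2 = t := Real.sq_sqrt ht.le
  obtain ⟨i, hi⟩ := exists_eigenvalues_gamma₁ k hs (by rw [hs2]; exact h)
  rw [(hasPairing_gamma₁ k).estradaIndex_eq_coshTail (bicyclic_gamma₁ k), Fintype.card_fin]
  obtain ⟨j, hj⟩ := (hasPairing_gamma₁ k).exists_neg i
  have hij : i ≠ j := by
    rintro rfl
    linarith
  have h1 := Finset.add_le_sum (s := univ)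
    (f := fun j => coshTail ((gamma₁ (k + 5)).eigenvalues j ^ 2))
    (fun _ _ => coshTail_nonneg (sq_nonneg _)) (Finset.mem_univ i) (Finset.mem_univ j) hij
  simp only [hj, neg_sq, hi, hs2] at h1
  push_cast
  linarith

/-- The four eigenvalues `±√t, ±√s` already exhaust `∑ μ² = 2(k + 6)`, so all others vanish. -/
theorem estradaIndex_gamma₂ (k : ℕ) {t s : ℝ} (hs : 0 < s) (hst : s < t) (hsum : t + s = k + 6)
    (hmul : t * s = 2 * k + 6) :
    (gamma₂ (k + 5)).estradaIndex = 2 * (k + 5 : ℝ) + 1 + (2 * coshTail t + 2 * coshTail s) := by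
  have ht : 0 < t := hs.trans hst
  have hrt : 0 < √t := Real.sqrt_pos.2 ht
  have hrt2 : √t ^ 2 = t := Real.sq_sqrt ht.le
  have hrs : 0 < √s := Real.sqrt_pos.2 hs
  have hrs2 : √s ^ 2 = s := Real.sq_sqrt hs.le
  have hlt : √s < √t := Real.sqrt_lt_sqrt hs.le hst
  obtain ⟨i, hi⟩ := exists_eigenvalues_gamma₂ k hrt
    (by rw [hrt2, ← hmul, ← hsum]; ring)
  obtain ⟨j, hj⟩ := exists_eigenvalues_gamma₂ k hrs
    (by rw [hrs2, ← hmul, ← hsum]; ring)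
  have hp := hasPairing_gamma₂ k
  have hb := bicyclic_gamma₂ k
  rw [hp.estradaIndex_eq_coshTail hb, Fintype.card_fin]
  have hsq := (gamma₂ (k + 5)).sum_eigenvalues_sq
  rw [sum_intMatrix_sq, hb.2, Fintype.card_fin] at hsq
  obtain ⟨i', hi'⟩ := hp.exists_neg i
  obtain ⟨j', hj'⟩ := hp.exists_neg j
  rw [hi] at hi'
  rw [hj] at hj'
  generalize (gamma₂ (k + 5)).eigenvalues = e at *
  have n1 : i ≠ i' := by rintro rfl; linarith
  have n2 : i ≠ j := by rintro rfl; linarith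
  have n3 : i ≠ j' := by rintro rfl; linarith
  have n4 : i' ≠ j := by rintro rfl; linarith
  have n5 : i' ≠ j' := by rintro rfl; linarith
  have n6 : j ≠ j' := by rintro rfl; linarith
  have split : ∀ F : ℝ → ℝ, ∑ l, F (e l ^ 2) =
      ∑ l ∈ univ \ {i, i', j, j'}, F (e l ^ 2) + (2 * F t + 2 * F s) := by
    intro F
    rw [← Finset.sum_sdiff (Finset.subset_univ {i, i', j, j'})]
    congr 1
    rw [Finset.sum_insert (by simp [n1, n2, n3]), Finset.sum_insert (by simp [n4, n5]),
      Finset.sum_pair n6, hi, hi', hj, hj', neg_sq, neg_sq, hrt2, hrs2]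
    ring
  have h1 := split fun x => x
  rw [hsq] at h1
  have h2 : ∑ l ∈ univ \ {i, i', j, j'}, e l ^ 2 = 0 := by
    push_cast at h1
    linarith
  rw [Finset.sum_eq_zero_iff_of_nonneg fun l _ => sq_nonneg _] at h2
  rw [split coshTail, Finset.sum_eq_zero fun l hl => by rw [h2 l hl, coshTail_zero]]
  push_cast
  ring

end GammaSpectrum

/-! ### Comparison of the two extremal graphs -/

section Roots

/-- The two squared eigenvalues of `gamma₂ (k + 5)`. -/
theorem exists_roots_gamma₂ (k : ℕ) : ∃ t s : ℝ, 0 < s ∧ s < 2 ∧ 2 < t ∧ t + s = k + 6 ∧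
    t * s = 2 * k + 6 := by
  have hk : (0 : ℝ) ≤ k := Nat.cast_nonneg k
  have hr0 := Real.sqrt_nonneg ((k : ℝ) ^ 2 + 4 * k + 12)
  have hr := Real.sq_sqrt (by positivity : (0 : ℝ) ≤ (k : ℝ) ^ 2 + 4 * k + 12)
  set r := √((k : ℝ) ^ 2 + 4 * k + 12)
  refine ⟨(k + 6 + r) / 2, (k + 6 - r) / 2, ?_, ?_, ?_, by ring, ?_⟩ <;> nlinarith

theorem estradaIndex_gamma₂_lt_gamma₁ (k : ℕ) :
    (gamma₂ (k + 5)).estradaIndex < (gamma₁ (k + 5)).estradaIndex := by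
  obtain ⟨t, s, hs, hs2, ht2, hsum, hmul⟩ := exists_roots_gamma₂ k
  rw [estradaIndex_gamma₂ k hs (hs2.trans ht2) hsum hmul]
  have hk : (0 : ℝ) ≤ k := Nat.cast_nonneg k
  have hr0 := Real.sqrt_nonneg ((k : ℝ) ^ 2 + 6 * k + 25)
  have hr := Real.sq_sqrt (by positivity : (0 : ℝ) ≤ (k : ℝ) ^ 2 + 6 * k + 25)
  set r := √((k : ℝ) ^ 2 + 6 * k + 25)
  -- This is `t² + s² < T²` solved for `r`, where `T` is the larger root of the quadratic for
  -- `gamma₁`.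
  have hr3 : k + 3 + 8 / (k + 5) < r := by
    have h5 : (0 : ℝ) < k + 5 := by positivity
    rw [← lt_sub_iff_add_lt', div_lt_iff₀ h5]
    have hr5 : k + 3 ≤ r := by nlinarith
    by_contra! h
    have h6 : r * (k + 5) ≤ (k + 3) * (k + 5) + 8 := by linarith
    have h7 : (r * (k + 5)) ^ 2 ≤ ((k + 3) * (k + 5) + 8) ^ 2 := by
      gcongr
    rw [mul_pow, hr] at h7
    nlinarith
  set T := (k + 5 + r) / 2 with hT
  have hTe : T ^ 2 - (k + 5) * T + k = 0 := by
    rw [hT]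
    nlinarith
  have hTt : t ^ 2 + s ^ 2 < T ^ 2 := by
    have h5 : (0 : ℝ) < k + 5 := by positivity
    have h6 : (k + 5) * (k + 3 + 8 / (k + 5)) < (k + 5) * r := mul_lt_mul_of_pos_left hr3 h5
    have h7 : (k + 5 : ℝ) * (k + 3 + 8 / (k + 5)) = (k + 5) * (k + 3) + 8 := by
      field_simp
    have h8 : t ^ 2 + s ^ 2 = (k + 6) ^ 2 - 2 * (2 * k + 6) := by
      rw [← hsum, ← hmul]
      ring
    rw [h8]
    have h9 : T ^ 2 = (k + 5) * T - k := by linarith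
    rw [h9, hT]
    nlinarith
  have hT0 : 0 < T := by positivity
  have ht0 : 0 < t := by linarith
  have htT : t ≤ T := by
    by_contra! h
    nlinarith
  refine lt_of_lt_of_le ?_ (estradaIndex_gamma₁_ge k hT0 hTe)
  have key := sum_coshTail_lt (univ : Finset (Fin 2)) (univ : Finset (Fin 1)) (f := ![t, s])
    (g := ![T]) (fun i _ => by fin_cases i <;> simp <;> linarith)
    (fun i _ => by fin_cases i; simpa using hT0.le) (fun m => ?_) ?_
  · simp at key
    linarith
  · simp
    have h1 : t ^ m ≤ T ^ m := pow_le_pow_left₀ ht0.le htT m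
    have h2 : s ^ m ≤ T ^ m := pow_le_pow_left₀ hs.le (by linarith) m
    calc t ^ (m + 2) + s ^ (m + 2) = t ^ 2 * t ^ m + s ^ 2 * s ^ m := by ring
      _ ≤ t ^ 2 * T ^ m + s ^ 2 * T ^ m := by gcongr
      _ = (t ^ 2 + s ^ 2) * T ^ m := by ring
      _ ≤ T ^ 2 * T ^ m := by gcongr
      _ = T ^ (m + 2) := by ring
  · simpa using hTt

end Roots

/-! ### Comparison of other graphs with the second extremal graph -/

section Comparison

variable {V : Type*} [Fintype V] [DecidableEq V] {Γ : SignedGraph V}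

/-- A nonzero eigenvalue and its negative are two separate terms of the sum. -/
theorem HasPairing.two_mul_eigenvalues_four_le (h : Γ.HasPairing) (i : V) :
    2 * (Γ.eigenvalues i ^ 2) ^ 2 ≤ ∑ j, Γ.eigenvalues j ^ 4 := by
  by_cases hi : Γ.eigenvalues i = 0
  · rw [hi]
    simpa using Finset.sum_nonneg fun j (_ : j ∈ univ) => by positivity
  obtain ⟨j, hj⟩ := h.exists_neg i
  have hij : i ≠ j := by
    rintro rfl
    exact hi (by linarith)
  have h1 := Finset.add_le_sum (s := univ) (f := fun j => Γ.eigenvalues j ^ 4)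
    (fun _ _ => by positivity) (Finset.mem_univ i) (Finset.mem_univ j) hij
  simp only [hj] at h1
  nlinarith

/-- A sharper bound from the Cauchy–Schwarz inequality for the remaining eigenvalues. -/
theorem HasPairing.sq_sum_sub_le (h : Γ.HasPairing) {i : V} (hi : Γ.eigenvalues i ≠ 0) :
    (∑ j, Γ.eigenvalues j ^ 2 - 2 * Γ.eigenvalues i ^ 2) ^ 2 ≤
      (Fintype.card V - 2) * (∑ j, Γ.eigenvalues j ^ 4 - 2 * (Γ.eigenvalues i ^ 2) ^ 2) := by
  obtain ⟨j, hj⟩ := h.exists_neg i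
  have hij : i ≠ j := by
    rintro rfl
    exact hi (by linarith)
  have split : ∀ F : ℝ → ℝ, ∑ l, F (Γ.eigenvalues l) - (F (Γ.eigenvalues i) +
      F (Γ.eigenvalues j)) = ∑ l ∈ univ \ {i, j}, F (Γ.eigenvalues l) := by
    intro F
    rw [← Finset.sum_sdiff (Finset.subset_univ {i, j}), Finset.sum_pair hij]
    ring
  have h1 := split fun x => x ^ 2
  have h2 := split fun x => x ^ 4
  have h3 := sq_sum_le_card_mul_sum_sq (s := univ \ {i, j}) (f := fun l => Γ.eigenvalues l ^ 2)
  have h4 : (#(univ \ {i, j} : Finset V) : ℝ) = Fintype.card V - 2 := by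
    have h5 := Finset.card_sdiff_add_card_eq_card (Finset.subset_univ {i, j})
    rw [Finset.card_pair hij, Finset.card_univ] at h5
    rw [← h5]
    push_cast
    ring
  simp only [hj] at h1 h2
  rw [← h1, h4] at h3
  simp only [← pow_mul] at h3
  rw [← h2] at h3
  refine le_trans (le_of_eq ?_) (h3.trans (le_of_eq ?_)) <;> ring

theorem estradaIndex_lt_gamma₂_of_quartic {k : ℕ} {Γ : SignedGraph (Fin (k + 5))}
    (hp : Γ.HasPairing) (hb : Γ.Bicyclic)
    (hq : quartic Γ.intMatrix ≤ 2 * (k + 5 : ℤ) ^ 2 - 8 * (k + 5) + 38)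
    (hq5 : k = 0 → quartic Γ.intMatrix ≤ 44) :
    Γ.estradaIndex < (gamma₂ (k + 5)).estradaIndex := by
  obtain ⟨t, s, hs, hs2, ht2, hsum, hmul⟩ := exists_roots_gamma₂ k
  rw [estradaIndex_gamma₂ k hs (hs2.trans ht2) hsum hmul, hp.estradaIndex_eq_coshTail hb,
    Fintype.card_fin]
  push_cast
  refine add_lt_add_right ?_ _
  have ht0 : 0 < t := by linarith
  have hk : (0 : ℝ) ≤ k := Nat.cast_nonneg k
  have h4 := Γ.sum_eigenvalues_four
  have hq' : (quartic Γ.intMatrix : ℝ) ≤ 2 * (k + 5 : ℝ) ^ 2 - 8 * (k + 5) + 38 := by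
    exact_mod_cast hq
  have hts : t ^ 2 + s ^ 2 = (k + 6) ^ 2 - 2 * (2 * k + 6) := by
    rw [← hsum, ← hmul]
    ring
  -- For order six the bound `62` slightly exceeds `2t² ≈ 61.9`, so the general argument with `C =
  -- t²` fails.
  by_cases h1 : k = 1
  · subst h1
    norm_num at hq' hsum hmul hts
    -- With `x = μ²`, the Cauchy–Schwarz bound for `∑ μ² = 14` and `∑ μ⁴ ≤ 62` reads `3x² - 14x - 13
    -- ≤ 0`, hence `x < 5.5`.
    have hB : ∀ i, Γ.eigenvalues i ^ 2 ≤ 11 / 2 := by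
      intro i
      by_cases hi : Γ.eigenvalues i = 0
      · rw [hi]
        norm_num
      have h5 := hp.sq_sum_sub_le hi
      have h6 := Γ.sum_eigenvalues_sq
      rw [sum_intMatrix_sq, hb.2] at h6
      rw [h4, h6] at h5
      norm_num at h5
      by_contra! h7
      nlinarith
    have ht5 : 11 / 2 ≤ t := by nlinarith
    -- Here `t² + s² = 33` absorbs `C = 31` in the fourth moment; from the sixth moment on `t` alone
    -- suffices.
    have ht3 : 31 * (11 / 2) ≤ t ^ 3 := by
      have h8 : s = 7 - t := by linarith
      have h9 : t ^ 2 = 7 * t - 8 := by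
        rw [h8] at hmul
        linarith
      have h10 : 5.561 ≤ t := by nlinarith
      have h11 : t ^ 3 = 41 * t - 56 := by
        have : t ^ 3 = t * t ^ 2 := by ring
        rw [this, h9]
        linear_combination 7 * h9
      rw [h11]
      linarith
    refine sum_coshTail_eigenvalues_lt (B := 11 / 2) (C := 31) ht0.le hs.le hB
      (by rw [h4]; linarith) (fun m => ?_) (by rw [hts]; norm_num)
    rcases m with _ | m
    · norm_num
      rw [hts]
      norm_num
    · have h12 : (11 / 2 : ℝ) ^ m ≤ t ^ m := pow_le_pow_left₀ (by norm_num) ht5 m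
      calc (31 : ℝ) * (11 / 2) ^ (m + 1) = 31 * (11 / 2) * (11 / 2) ^ m := by ring
        _ ≤ t ^ 3 * t ^ m := by gcongr
        _ = t ^ (m + 1 + 2) := by ring
        _ ≤ t ^ (m + 1 + 2) + s ^ (m + 1 + 2) := le_add_of_nonneg_right (by positivity)
  · have hqt : (quartic Γ.intMatrix : ℝ) ≤ 2 * t ^ 2 := by
      rcases Nat.eq_zero_or_pos k with rfl | hpos
      · have h5 : (quartic Γ.intMatrix : ℝ) ≤ 44 := by exact_mod_cast hq5 rfl
        norm_num at hsum hmul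
        have h8 : s = 6 - t := by linarith
        have h9 : t ^ 2 = 6 * t - 6 := by
          rw [h8] at hmul
          linarith
        nlinarith
      · have hk2 : (2 : ℝ) ≤ k := by exact_mod_cast (by omega : 2 ≤ k)
        nlinarith
    refine sum_coshTail_eigenvalues_lt (B := t) (C := t ^ 2) ht0.le hs.le (fun i => ?_)
      (by rw [h4]; exact hqt) (fun m => ?_) (by nlinarith)
    · have h5 := hp.two_mul_eigenvalues_four_le i
      rw [h4] at h5
      exact le_of_sq_le_sq (by linarith) ht0.le
    · rw [← pow_add, add_comm 2 m]
      exact le_add_of_nonneg_right (by positivity)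

end Comparison

/-! ### Switching equivalence in matrix form -/

section Switching

theorem intMatrix_switch {V : Type*} (Γ : SignedGraph V) {θ : V → ℤ}
    (hθ : ∀ u, θ u = 1 ∨ θ u = -1) (u v : V) :
    (Γ.switch {u | θ u = -1}).intMatrix u v = switchMatrix Γ.intMatrix θ u v := by
  simp only [switchMatrix, Matrix.of_apply]
  by_cases h : Γ.graph.Adj u v
  · rw [Γ.intMatrix_of_adj h, (Γ.switch {u | θ u = -1}).intMatrix_of_adj (u := u) (v := v) h]
    have hcut : s(u, v) ∈ cut {u | θ u = -1} ↔ θ u ≠ θ v := by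
      constructor
      · rintro ⟨a, ha, b, hb, hab⟩
        simp only [Set.mem_ofPred_eq] at ha hb
        rcases Sym2.eq_iff.1 hab with ⟨rfl, rfl⟩ | ⟨rfl, rfl⟩
        · rw [ha]; exact Ne.symm hb
        · rw [ha]; exact hb
      · intro hne
        rcases hθ u with hu | hu
        · have hv := (hθ v).resolve_left fun hv => hne (hu.trans hv.symm)
          exact ⟨v, hv, u, by simp [hu], Sym2.eq_swap⟩
        · have hv := (hθ v).resolve_right fun hv => hne (hu.trans hv.symm)
          exact ⟨u, hu, v, by simp [hv], rfl⟩
    simp only [adjSign, switch, hcut]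
    rcases hθ u with hu | hu <;> rcases hθ v with hv | hv <;> simp [hu, hv]
  · rw [Γ.intMatrix_of_not_adj h,
      (Γ.switch {u | θ u = -1}).intMatrix_of_not_adj (u := u) (v := v) h, mul_zero]

theorem switchingEquivalent_of_equiv {V W : Type*} {Γ : SignedGraph V} {Δ : SignedGraph W}
    {θ : V → ℤ} (hθ : ∀ u, θ u = 1 ∨ θ u = -1) (e : W ≃ V)
    (h : ∀ i j, Δ.intMatrix i j = switchMatrix Γ.intMatrix θ (e i) (e j)) :
    Γ.SwitchingEquivalent Δ := by
  have h' : ∀ u v, Δ.intMatrix (e.symm u) (e.symm v) =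
      (Γ.switch {u | θ u = -1}).intMatrix u v := by
    intro u v
    rw [h, intMatrix_switch Γ hθ, e.apply_symm_apply, e.apply_symm_apply]
  refine ⟨{u | θ u = -1}, ⟨e.symm, ?_⟩, fun u v huv => Units.ext ?_⟩
  · intro u v
    rw [← intMatrix_ne_zero_iff, h', intMatrix_ne_zero_iff]
  · rw [← intMatrix_of_adj, ← intMatrix_of_adj]
    exact h' u v

end Switching

/-! ### Classification of graphs with a vertex adjacent to all others -/

section Center

variable {V : Type*} [Fintype V] [DecidableEq V] {B : Matrix V V ℤ} {c : V}

/-- Otherwise every edge is positive and the constant `1` is a potential. -/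
theorem _root_.IsUnbalancedBicyclic.exists_neg_of_center (hB : IsUnbalancedBicyclic B)
    (hc : ∀ u, u ≠ c → B c u = 1) : ∃ x y, x ≠ c ∧ y ≠ c ∧ B x y = -1 := by
  by_contra! hno
  refine hB.unbalanced (fun _ => 1) ⟨fun _ => Or.inl rfl, fun u v huv => ?_⟩
  by_cases hu : u = c
  · rw [hu] at huv ⊢
    exact hc v (hB.toIsSignedAdj.ne_of_ne_zero huv).symm
  by_cases hv : v = c
  · rw [hv, hB.symm]
    exact hc u hu
  exact ((hB.entry u v).resolve_left huv).resolve_right (hno u v hu hv)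

/-- Otherwise every triangle is negative, and the negative edge off `c` makes one with `c`,
contradicting `cubic`. -/
theorem _root_.IsUnbalancedBicyclic.exists_pos_of_center (hB : IsUnbalancedBicyclic B)
    (hc : ∀ u, u ≠ c → B c u = 1) : ∃ x y, x ≠ c ∧ y ≠ c ∧ B x y = 1 := by
  by_contra! hno
  have hc' : ∀ u, u ≠ c → B u c = 1 := fun u hu => by rw [hB.symm]; exact hc u hu
  have hent : ∀ x y, x ≠ c → y ≠ c → B x y = 0 ∨ B x y = -1 := fun x y hx hy => by
    rcases hB.entry x y with h | h | h
    · exact Or.inl h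
    · exact absurd h (hno x y hx hy)
    · exact Or.inr h
  have hle : ∀ x y z, B x y * B y z * B z x ≤ 0 := by
    intro x y z
    by_cases hx : x = c <;> by_cases hy : y = c <;> by_cases hz : z = c
    · simp [hx, hy, hB.diag]
    · simp [hx, hy, hB.diag]
    · simp [hx, hz, hB.diag]
    · rw [hx, hc y hy, hc' z hz]
      rcases hent y z hy hz with h | h <;> simp [h]
    · simp [hy, hz, hB.diag]
    · rw [hy, hc' x hx, hc z hz]
      rcases hent z x hz hx with h | h <;> simp [h]
    · rw [hz, hc' y hy, hc x hx]
      rcases hent x y hx hy with h | h <;> simp [h]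
    · rcases hent x y hx hy with h | h <;> rcases hent y z hy hz with h' | h' <;>
        rcases hent z x hz hx with h'' | h'' <;> simp [h, h', h'']
  obtain ⟨x, y, hx, hy, hxy⟩ := hB.exists_neg_of_center hc
  have hz := hB.cubic
  rw [Finset.sum_eq_zero_iff_of_nonpos fun x _ => Finset.sum_nonpos fun y _ =>
    Finset.sum_nonpos fun z _ => hle x y z] at hz
  have hz := hz c (Finset.mem_univ _)
  rw [Finset.sum_eq_zero_iff_of_nonpos fun y _ =>
    Finset.sum_nonpos fun z _ => hle c y z] at hz
  have hz := hz x (Finset.mem_univ _)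
  rw [Finset.sum_eq_zero_iff_of_nonpos fun z _ => hle c x z] at hz
  have hz := hz y (Finset.mem_univ _)
  rw [hc x hx, hxy, hc' y hy] at hz
  norm_num at hz

/-- Of the `n + 1` edges, `n - 1` meet `c`. The other two give four ordered pairs, already exhausted
by `pq` and `rs` in both orders. -/
theorem _root_.IsUnbalancedBicyclic.eq_of_center (hB : IsUnbalancedBicyclic B)
    (hc : ∀ u, u ≠ c → B c u = 1) {p q r s : V} (hp : p ≠ c) (hq : q ≠ c) (hr : r ≠ c)
    (hs : s ≠ c) (hpq : B p q = 1) (hrs : B r s = -1) {x y : V} (hx : x ≠ c) (hy : y ≠ c)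
    (hxy : B x y ≠ 0) :
    (x = p ∧ y = q) ∨ (x = q ∧ y = p) ∨ (x = r ∧ y = s) ∨ (x = s ∧ y = r) := by
  set S : Finset (V × V) := {t | t.1 ≠ c ∧ t.2 ≠ c ∧ B t.1 t.2 ≠ 0} with hS
  have hcard : (#S : ℤ) = 4 := by
    have h1 : (#S : ℤ) = ∑ u : {u // u ≠ c}, ∑ v : {v // v ≠ c}, B u v ^ 2 := by
      rw [hS, ← Finset.sum_boole, Fintype.sum_prod_type, sum_eq_add_sum_ne c]
      simp only [ne_eq, not_true_eq_false, false_and, if_false, Finset.sum_const_zero, zero_add]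
      refine Finset.sum_congr rfl fun u _ => ?_
      rw [sum_eq_add_sum_ne c]
      simp only [not_true_eq_false, false_and, and_false, if_false, zero_add, u.2,
        not_false_eq_true, true_and]
      refine Finset.sum_congr rfl fun v _ => ?_
      rw [hB.toIsSignedAdj.sq_eq]
      simp [v.2]
    have h2 := hB.size
    rw [sum_eq_add_sum_ne c, sum_eq_add_sum_ne c, hB.diag] at h2
    simp only [fun u => sum_eq_add_sum_ne c fun v => B u v ^ 2, Finset.sum_add_distrib] at h2
    have h3 : ∑ u : {u // u ≠ c}, B c u ^ 2 = (Fintype.card V : ℤ) - 1 := by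
      have h4 : 0 < Fintype.card V := Fintype.card_pos_iff.2 ⟨c⟩
      rw [Finset.sum_congr rfl fun (u : {u // u ≠ c}) _ => by rw [hc u u.2]]
      simp [Nat.cast_sub h4]
    have h5 : ∑ u : {u // u ≠ c}, B u c ^ 2 = ∑ u : {u // u ≠ c}, B c u ^ 2 :=
      Finset.sum_congr rfl fun u _ => by rw [hB.symm]
    rw [h5, h3] at h2
    rw [h1]
    linarith
  have hqp : B q p = 1 := by rw [hB.symm, hpq]
  have hsr : B s r = -1 := by rw [hB.symm, hrs]
  have npq : p ≠ q := hB.toIsSignedAdj.ne_of_ne_zero (by rw [hpq]; norm_num)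
  have nrs : r ≠ s := hB.toIsSignedAdj.ne_of_ne_zero (by rw [hrs]; norm_num)
  have n1 : ∀ a b a' b', B a b = 1 → B a' b' = -1 → (a, b) ≠ (a', b') := by
    rintro a b a' b' h h' ⟨⟩
    rw [h] at h'
    norm_num at h'
  have hsub : ({(p, q), (q, p), (r, s), (s, r)} : Finset (V × V)) ⊆ S := by
    intro t ht
    simp only [Finset.mem_insert, Finset.mem_singleton] at ht
    rcases ht with rfl | rfl | rfl | rfl <;> simp [hS, hp, hq, hr, hs, hpq, hqp, hrs, hsr]
  have hfour : #({(p, q), (q, p), (r, s), (s, r)} : Finset (V × V)) = 4 := by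
    have m1 : (p, q) ≠ (q, p) := fun h => npq (congrArg Prod.fst h)
    have m2 : (r, s) ≠ (s, r) := fun h => nrs (congrArg Prod.fst h)
    rw [Finset.card_insert_of_notMem, Finset.card_insert_of_notMem, Finset.card_pair m2]
    · simp only [Finset.mem_insert, Finset.mem_singleton, not_or]
      exact ⟨n1 _ _ _ _ hqp hrs, n1 _ _ _ _ hqp hsr⟩
    · simp only [Finset.mem_insert, Finset.mem_singleton, not_or]
      exact ⟨m1, n1 _ _ _ _ hpq hrs, n1 _ _ _ _ hpq hsr⟩
  have heq := Finset.eq_of_subset_of_card_le hsub (by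
    rw [hfour]
    exact_mod_cast hcard.le)
  have hmem : (x, y) ∈ S := by simp [hS, hx, hy, hxy]
  rw [← heq] at hmem
  simpa using hmem

theorem exists_equiv_gamma₂ {n : ℕ} (hn : Fintype.card V = n) (hn4 : 4 ≤ n)
    (hB : IsSignedAdj B) (hc : ∀ u, u ≠ c → B c u = 1) {p q s : V} (hp : p ≠ c) (hq : q ≠ c)
    (hs : s ≠ c) (hpq : B p q = 1) (hps : B p s = -1)
    (hrest : ∀ x y, x ≠ c → y ≠ c → B x y ≠ 0 →
      (x = p ∧ y = q) ∨ (x = q ∧ y = p) ∨ (x = p ∧ y = s) ∨ (x = s ∧ y = p)) :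
    ∃ e : Fin n ≃ V, ∀ i j : Fin n, gammaEntry₂ i j = B (e i) (e j) := by
  have npq : p ≠ q := hB.ne_of_ne_zero (by rw [hpq]; norm_num)
  have nps : p ≠ s := hB.ne_of_ne_zero (by rw [hps]; norm_num)
  have nqs : q ≠ s := by
    rintro rfl
    rw [hpq] at hps
    norm_num at hps
  have hinj : Function.Injective ![c, p, q, s] := by
    intro i j h
    fin_cases i <;> fin_cases j <;> simp_all [eq_comm]
  obtain ⟨e, he⟩ := exists_equiv_extend hn hn4 hinj
  have h0 : ∀ i : Fin n, e i = c ↔ (i : ℕ) = 0 := fun i => by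
    rw [← (show _ = c from he 0), e.injective.eq_iff, Fin.ext_iff]; rfl
  have h1 : ∀ i : Fin n, e i = p ↔ (i : ℕ) = 1 := fun i => by
    rw [← (show _ = p from he 1), e.injective.eq_iff, Fin.ext_iff]; rfl
  have h2 : ∀ i : Fin n, e i = q ↔ (i : ℕ) = 2 := fun i => by
    rw [← (show _ = q from he 2), e.injective.eq_iff, Fin.ext_iff]; rfl
  have h3 : ∀ i : Fin n, e i = s ↔ (i : ℕ) = 3 := fun i => by
    rw [← (show _ = s from he 3), e.injective.eq_iff, Fin.ext_iff]; rfl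
  refine ⟨e, fun i j => ?_⟩
  by_cases hij : i = j
  · simp [hij, hB.diag, gammaEntry₂]
  have hij' : (i : ℕ) ≠ j := fun h => hij (Fin.ext h)
  by_cases hi : e i = c
  · rw [hi, hc _ (fun h => hij (e.injective (hi.trans h.symm)))]
    simp [gammaEntry₂, (h0 i).1 hi]
    exact fun h => absurd ((h0 i).1 hi |>.trans h) hij'
  by_cases hj : e j = c
  · rw [hj, hB.symm, hc _ hi]
    simp [gammaEntry₂, (h0 j).1 hj]
    exact fun h => hi ((h0 i).2 h)
  have hi0 : (i : ℕ) ≠ 0 := fun h => hi ((h0 i).2 h)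
  have hj0 : (j : ℕ) ≠ 0 := fun h => hj ((h0 j).2 h)
  by_cases hz : B (e i) (e j) = 0
  · rw [hz]
    unfold gammaEntry₂
    rw [if_neg hij', if_neg (by omega)]
    split_ifs with g1 g2
    · exfalso
      rcases g1 with ⟨g, g'⟩ | ⟨g, g'⟩
      · rw [(h1 i).2 g, (h3 j).2 g', hps] at hz
        norm_num at hz
      · rw [(h3 i).2 g, (h1 j).2 g', hB.symm, hps] at hz
        norm_num at hz
    · exfalso
      rcases g2 with ⟨g, g'⟩ | ⟨g, g'⟩
      · rw [(h1 i).2 g, (h2 j).2 g', hpq] at hz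
        norm_num at hz
      · rw [(h2 i).2 g, (h1 j).2 g', hB.symm, hpq] at hz
        norm_num at hz
    · rfl
  · rcases hrest _ _ hi hj hz with ⟨g, g'⟩ | ⟨g, g'⟩ | ⟨g, g'⟩ | ⟨g, g'⟩
    · rw [g, g', hpq, (h1 i).1 g, (h2 j).1 g']; rfl
    · rw [g, g', hB.symm, hpq, (h2 i).1 g, (h1 j).1 g']; rfl
    · rw [g, g', hps, (h1 i).1 g, (h3 j).1 g']; rfl
    · rw [g, g', hB.symm, hps, (h3 i).1 g, (h1 j).1 g']; rfl

theorem exists_equiv_gamma₁ {n : ℕ} (hn : Fintype.card V = n) (hn5 : 5 ≤ n)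
    (hB : IsSignedAdj B) (hc : ∀ u, u ≠ c → B c u = 1) {p q r s : V} (hp : p ≠ c) (hq : q ≠ c)
    (hr : r ≠ c) (hs : s ≠ c) (hpq : B p q = 1) (hrs : B r s = -1)
    (hpr : p ≠ r) (hps : p ≠ s) (hqr : q ≠ r) (hqs : q ≠ s)
    (hrest : ∀ x y, x ≠ c → y ≠ c → B x y ≠ 0 →
      (x = p ∧ y = q) ∨ (x = q ∧ y = p) ∨ (x = r ∧ y = s) ∨ (x = s ∧ y = r)) :
    ∃ e : Fin n ≃ V, ∀ i j : Fin n, gammaEntry₁ i j = B (e i) (e j) := by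
  have npq : p ≠ q := hB.ne_of_ne_zero (by rw [hpq]; norm_num)
  have nrs : r ≠ s := hB.ne_of_ne_zero (by rw [hrs]; norm_num)
  -- The order puts the negative edge at `1 2` and the positive one at `3 4`, as in `gamma₁`.
  have hinj : Function.Injective ![c, r, s, p, q] := by
    intro i j h
    fin_cases i <;> fin_cases j <;> simp_all [eq_comm]
  obtain ⟨e, he⟩ := exists_equiv_extend hn hn5 hinj
  have h0 : ∀ i : Fin n, e i = c ↔ (i : ℕ) = 0 := fun i => by
    rw [← (show _ = c from he 0), e.injective.eq_iff, Fin.ext_iff]; rfl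
  have h1 : ∀ i : Fin n, e i = r ↔ (i : ℕ) = 1 := fun i => by
    rw [← (show _ = r from he 1), e.injective.eq_iff, Fin.ext_iff]; rfl
  have h2 : ∀ i : Fin n, e i = s ↔ (i : ℕ) = 2 := fun i => by
    rw [← (show _ = s from he 2), e.injective.eq_iff, Fin.ext_iff]; rfl
  have h3 : ∀ i : Fin n, e i = p ↔ (i : ℕ) = 3 := fun i => by
    rw [← (show _ = p from he 3), e.injective.eq_iff, Fin.ext_iff]; rfl
  have h4 : ∀ i : Fin n, e i = q ↔ (i : ℕ) = 4 := fun i => by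
    rw [← (show _ = q from he 4), e.injective.eq_iff, Fin.ext_iff]; rfl
  refine ⟨e, fun i j => ?_⟩
  by_cases hij : i = j
  · simp [hij, hB.diag, gammaEntry₁]
  have hij' : (i : ℕ) ≠ j := fun h => hij (Fin.ext h)
  by_cases hi : e i = c
  · rw [hi, hc _ (fun h => hij (e.injective (hi.trans h.symm)))]
    simp [gammaEntry₁, (h0 i).1 hi]
    exact fun h => absurd ((h0 i).1 hi |>.trans h) hij'
  by_cases hj : e j = c
  · rw [hj, hB.symm, hc _ hi]
    simp [gammaEntry₁, (h0 j).1 hj]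
    exact fun h => hi ((h0 i).2 h)
  have hi0 : (i : ℕ) ≠ 0 := fun h => hi ((h0 i).2 h)
  have hj0 : (j : ℕ) ≠ 0 := fun h => hj ((h0 j).2 h)
  by_cases hz : B (e i) (e j) = 0
  · rw [hz]
    unfold gammaEntry₁
    rw [if_neg hij', if_neg (by omega)]
    split_ifs with g1 g2
    · exfalso
      rcases g1 with ⟨g, g'⟩ | ⟨g, g'⟩
      · rw [(h1 i).2 g, (h2 j).2 g', hrs] at hz
        norm_num at hz
      · rw [(h2 i).2 g, (h1 j).2 g', hB.symm, hrs] at hz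
        norm_num at hz
    · exfalso
      rcases g2 with ⟨g, g'⟩ | ⟨g, g'⟩
      · rw [(h3 i).2 g, (h4 j).2 g', hpq] at hz
        norm_num at hz
      · rw [(h4 i).2 g, (h3 j).2 g', hB.symm, hpq] at hz
        norm_num at hz
    · rfl
  · rcases hrest _ _ hi hj hz with ⟨g, g'⟩ | ⟨g, g'⟩ | ⟨g, g'⟩ | ⟨g, g'⟩
    · rw [g, g', hpq, (h3 i).1 g, (h4 j).1 g']; rfl
    · rw [g, g', hB.symm, hpq, (h4 i).1 g, (h3 j).1 g']; rfl
    · rw [g, g', hrs, (h1 i).1 g, (h2 j).1 g']; rfl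
    · rw [g, g', hB.symm, hrs, (h2 i).1 g, (h1 j).1 g']; rfl

/-- An unbalanced bicyclic signed graph with a vertex adjacent to all others and as many positive
as negative triangles is one of the two extremal graphs. -/
theorem switchingEquivalent_of_center {Γ : SignedGraph V} (hA : IsUnbalancedBicyclic Γ.intMatrix)
    {n : ℕ} (hn : Fintype.card V = n) (hn5 : 5 ≤ n) (hc : vertexDeg Γ.intMatrix c = n - 1) :
    Γ.SwitchingEquivalent (gamma₁ n) ∨ Γ.SwitchingEquivalent (gamma₂ n) := by
  have hcv : ∀ v, v ≠ c → Γ.intMatrix c v ≠ 0 := fun v hv =>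
    hA.toIsSignedAdj.ne_zero_of_vertexDeg_eq (by rw [hc, hn]) hv
  -- Switching by the signs at `c` makes all edges at `c` positive.
  let θ : V → ℤ := fun v => if v = c then 1 else Γ.intMatrix c v
  have hθ : ∀ v, θ v = 1 ∨ θ v = -1 := by
    intro v
    by_cases h : v = c
    · simp [θ, h]
    · simpa [θ, h] using (hA.entry c v).resolve_left (hcv v h)
  have hB := hA.switch hθ
  have hBc : ∀ u, u ≠ c → switchMatrix Γ.intMatrix θ c u = 1 := by
    intro u hu
    simp only [switchMatrix, Matrix.of_apply, θ, if_true, hu, if_false, one_mul]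
    rw [← sq]
    exact hA.toIsSignedAdj.sq_eq_one (hcv u hu)
  obtain ⟨p, q, hp, hq, hpq⟩ := hB.exists_pos_of_center hBc
  obtain ⟨r, s, hr, hs, hrs⟩ := hB.exists_neg_of_center hBc
  have hrest := fun x y (hx : x ≠ c) (hy : y ≠ c) => hB.eq_of_center hBc hp hq hr hs hpq hrs
    (x := x) (y := y) hx hy
  have hqp : switchMatrix Γ.intMatrix θ q p = 1 := by rw [hB.symm, hpq]
  have hsr : switchMatrix Γ.intMatrix θ s r = -1 := by rw [hB.symm, hrs]
  -- Covers all four ways in which the positive and the negative edge can share an end.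
  have shared : ∀ p q s, p ≠ c → q ≠ c → s ≠ c → switchMatrix Γ.intMatrix θ p q = 1 →
      switchMatrix Γ.intMatrix θ p s = -1 →
      Γ.SwitchingEquivalent (gamma₂ n) := by
    intro p q s hp hq hs hpq hps
    obtain ⟨e, he⟩ := exists_equiv_gamma₂ hn (by omega) hB.toIsSignedAdj hBc hp hq hs hpq hps
      fun x y hx hy => hB.eq_of_center hBc hp hq hp hs hpq hps hx hy
    exact switchingEquivalent_of_equiv hθ e fun i j => by rw [intMatrix_gamma₂, he]
  by_cases h1 : p = r
  · exact Or.inr (shared p q s hp hq hs hpq (h1 ▸ hrs))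
  by_cases h2 : p = s
  · exact Or.inr (shared p q r hp hq hr hpq (h2 ▸ hsr))
  by_cases h3 : q = r
  · exact Or.inr (shared q p s hq hp hs hqp (h3 ▸ hrs))
  by_cases h4 : q = s
  · exact Or.inr (shared q p r hq hp hr hqp (h4 ▸ hsr))
  obtain ⟨e, he⟩ := exists_equiv_gamma₁ hn hn5 hB.toIsSignedAdj hBc hp hq hr hs hpq hrs h1 h2 h3 h4
    hrest
  exact Or.inl (switchingEquivalent_of_equiv hθ e fun i j => by rw [intMatrix_gamma₁, he])

end Center

end SignedGraph

theorem theorem3p7 (n : ℕ) (hn : 5 ≤ n) :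
    SignedGraph.gamma₁ n ∈ SignedGraph.unbalancedBicyclicPairing n ∧
    SignedGraph.gamma₂ n ∈ SignedGraph.unbalancedBicyclicPairing n ∧
    (SignedGraph.gamma₂ n).estradaIndex < (SignedGraph.gamma₁ n).estradaIndex ∧
    ∀ Γ ∈ SignedGraph.unbalancedBicyclicPairing n,
      ¬ Γ.SwitchingEquivalent (SignedGraph.gamma₁ n) →
      ¬ Γ.SwitchingEquivalent (SignedGraph.gamma₂ n) →
      Γ.estradaIndex < (SignedGraph.gamma₂ n).estradaIndex := by
  obtain ⟨k, rfl⟩ : ∃ k, n = k + 5 := ⟨n - 5, by omega⟩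
  refine ⟨⟨SignedGraph.bicyclic_gamma₁ k, SignedGraph.not_balanced_gamma₁ k,
    SignedGraph.hasPairing_gamma₁ k⟩, ⟨SignedGraph.bicyclic_gamma₂ k,
    SignedGraph.not_balanced_gamma₂ k, SignedGraph.hasPairing_gamma₂ k⟩,
    SignedGraph.estradaIndex_gamma₂_lt_gamma₁ k, ?_⟩
  rintro Γ ⟨hb, hu, hp⟩ h1 h2
  have hA := SignedGraph.isUnbalancedBicyclic_intMatrix hb hu hp
  have hbounds := (quartic_bounds (k + 5) (Fin (k + 5)) Γ.intMatrix hA (Fintype.card_fin _)).1 ?_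
  · refine SignedGraph.estradaIndex_lt_gamma₂_of_quartic hp hb ?_ fun hk => hbounds.2 (by omega)
    have := hbounds.1
    push_cast at this
    exact this
  · intro c
    -- Degree `n - 1` is ruled out by the classification, so all degrees are at most `n - 2`.
    have h3 : vertexDeg Γ.intMatrix c ≠ ((k + 5 : ℕ) : ℤ) - 1 := fun hc =>
      (SignedGraph.switchingEquivalent_of_center hA (Fintype.card_fin _) hn hc).elim h1 h2
    have h4 := hA.toIsSignedAdj.vertexDeg_eq_card_sub c
    have h5 : 0 < #{v | Γ.intMatrix c v = 0} :=
      Finset.card_pos.2 ⟨c, by simpa using hA.diag c⟩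
    rw [Fintype.card_fin] at h4
    omega
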